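/- Let $C$ be a real analytic Banach manifold, given by an atlas of charts onto open subsets of real Banach spaces (which may vary from chart to chart) with real analytic coordinate changes. Let $J\colon TC\to TC$ be a real analytic almost complex structure on $C$, i.e. a real analytic map such that for every $p\in C$ it restricts to a bounded real-linear operator $J_p\colon T_pC\to T_pC$ with $J_p^2=-\mathrm{id}_{T_pC}$. In a chart, let $[a,b]_x=a'_x(b_x)-b'_x(a_x)$ denote the Lie bracket of smooth vector fields. Then there is exactly one smooth map $\Omega\colon TC\oplus TC\to TC$, mapping $T_pC\oplus T_pC$ into $T_pC$ for every $p\in C$ and called the torsion of $J$, such that $$\Omega(a,b)=J[Ja,b]+J[a,Jb]+[a,b]-[Ja,Jb]$$ for all smooth vector fields $a,b$ defined on an open subset of $C$. Moreover, $\Omega=0$ if and only if there exists on $C$ a structure of complex Banach manifold (an atlas of charts onto open subsets of complex Banach spaces, which may vary from chart to chart, with holomorphic coordinate changes) whose underlying real analytic structure is the original structure of $C$ and such that $J_pv=\mathrm{i}v$ for all $p\in C$ and $v\in T_pC$. -/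

import Mathlib

open Set
open scoped ContDiff

universe u v

noncomputable section

/-- An analytic Banach manifold structure over `𝕜` on the topological space `C`, given by an atlas:
around each point `p` a chosen chart, i.e. a homeomorphism from an open neighbourhood of `p` onto
an open subset of a Banach space `model p`, such that all coordinate changes are `𝕜`-analytic
(for `𝕜 = ℝ` real analytic, for `𝕜 = ℂ` holomorphic). The model spaces may vary from chart
to chart; coordinate changes force them to be isomorphic on overlapping charts only. -/
structure AnalyticAtlas (𝕜 : Type*) [NontriviallyNormedField 𝕜] (C : Type v)
    [TopologicalSpace C] where
  model : C → Type u
  [normedAddCommGroup : ∀ p, NormedAddCommGroup (model p)]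
  [normedSpace : ∀ p, NormedSpace 𝕜 (model p)]
  [completeSpace : ∀ p, CompleteSpace (model p)]
  chart : ∀ p, OpenPartialHomeomorph C (model p)
  mem_chart_source : ∀ p, p ∈ (chart p).source
  analytic_coordChange : ∀ p q,
    AnalyticOnNhd 𝕜 (chart q ∘ (chart p).symm) ((chart p).symm.trans (chart q)).source

namespace AnalyticAtlas

attribute [instance] AnalyticAtlas.normedAddCommGroup AnalyticAtlas.normedSpace
  AnalyticAtlas.completeSpace

section Basic

variable {𝕜 : Type*} [NontriviallyNormedField 𝕜] {C : Type v} [TopologicalSpace C]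

/-- The tangent space `T_p C`. Each tangent vector at `p` is represented by its coordinates in the
chosen chart around `p`. -/
abbrev Tangent (A : AnalyticAtlas.{u, v} 𝕜 C) (p : C) : Type u := A.model p

/-- For `q` in the domain of the chart around `p`: the map sending a tangent vector at `q` to its
coordinates in the chart around `p`, i.e. the differential of that chart at `q`. -/
def toCoord (A : AnalyticAtlas.{u, v} 𝕜 C) (p q : C) : A.Tangent q →L[𝕜] A.model p :=
  fderiv 𝕜 (A.chart p ∘ (A.chart q).symm) (A.chart q q)

/-- For `q` in the domain of the chart around `p`: the tangent vector at `q` with given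
coordinates in the chart around `p`. -/
def ofCoord (A : AnalyticAtlas.{u, v} 𝕜 C) (p q : C) : A.model p →L[𝕜] A.Tangent q :=
  fderiv 𝕜 (A.chart q ∘ (A.chart p).symm) (A.chart p q)

/-- Two atlases define the same analytic manifold structure: all coordinate changes from charts of
one atlas to charts of the other are analytic, in both directions. -/
def Equivalent (A B : AnalyticAtlas.{u, v} 𝕜 C) : Prop :=
  ∀ p q,
    AnalyticOnNhd 𝕜 (B.chart q ∘ (A.chart p).symm) ((A.chart p).symm.trans (B.chart q)).source ∧
    AnalyticOnNhd 𝕜 (A.chart p ∘ (B.chart q).symm) ((B.chart q).symm.trans (A.chart p)).source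

/-- The identification of the tangent spaces at `p` formed with two equivalent atlases. -/
def tangentIdent (A B : AnalyticAtlas.{u, v} 𝕜 C) (p : C) : A.Tangent p →L[𝕜] B.Tangent p :=
  fderiv 𝕜 (B.chart p ∘ (A.chart p).symm) (A.chart p p)

end Basic

variable {C : Type v} [TopologicalSpace C]

/-- The real analytic structure underlying a complex Banach manifold structure. -/
abbrev underlyingReal (B : AnalyticAtlas.{u, v} ℂ C) : AnalyticAtlas.{u, v} ℝ C where
  model := B.model
  normedAddCommGroup := B.normedAddCommGroup
  normedSpace := fun _ => NormedSpace.complexToReal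
  completeSpace := B.completeSpace
  chart := B.chart
  mem_chart_source := B.mem_chart_source
  analytic_coordChange := fun p q => (B.analytic_coordChange p q).restrictScalars

/-- The coordinate expression, in the chart around `p`, of a vector field `a` on `C`. -/
def fieldCoord (A : AnalyticAtlas.{u, v} ℝ C) (p : C) (a : ∀ q, A.Tangent q) :
    A.model p → A.model p :=
  fun x => A.toCoord p ((A.chart p).symm x) (a ((A.chart p).symm x))

/-- The vector field `a` is smooth on the open set `U`; its values outside `U` are irrelevant. -/
def SmoothFieldOn (A : AnalyticAtlas.{u, v} ℝ C) (a : ∀ q, A.Tangent q) (U : Set C) : Prop :=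
  ∀ p, ContDiffOn ℝ ∞ (A.fieldCoord p a) ((A.chart p).target ∩ (A.chart p).symm ⁻¹' U)

/-- The Lie bracket `[a, b] = a' b - b' a` of vector fields, computed at `p` in the chart
around `p`. -/
def bracket (A : AnalyticAtlas.{u, v} ℝ C) (a b : ∀ q, A.Tangent q) : ∀ q, A.Tangent q :=
  fun p =>
    fderiv ℝ (A.fieldCoord p a) (A.chart p p) (A.fieldCoord p b (A.chart p p)) -
      fderiv ℝ (A.fieldCoord p b) (A.chart p p) (A.fieldCoord p a (A.chart p p))

/-- An almost complex structure: bounded real-linear operators `J p` on the tangent spaces with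
`(J p) ^ 2 = -1`. -/
structure AlmostComplex (A : AnalyticAtlas.{u, v} ℝ C) where
  J : ∀ p, A.Tangent p →L[ℝ] A.Tangent p
  sq_eq_neg : ∀ p (w : A.Tangent p), J p (J p w) = -w

namespace AlmostComplex

variable {A : AnalyticAtlas.{u, v} ℝ C}

/-- `J : TC → TC` is real analytic: in the bundle charts `(x, w)` of `TC` it has the form
`(x, w) ↦ (x, J_x w)`, and `J_x w` is required to depend analytically on `(x, w)`. -/
def IsAnalytic (𝒥 : A.AlmostComplex) : Prop :=
  ∀ p, AnalyticOnNhd ℝ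
    (fun z : A.model p × A.model p =>
      A.toCoord p ((A.chart p).symm z.1)
        (𝒥.J ((A.chart p).symm z.1) (A.ofCoord p ((A.chart p).symm z.1) z.2)))
    ((A.chart p).target ×ˢ univ)

/-- The vector field `J a`. -/
def mapField (𝒥 : A.AlmostComplex) (a : ∀ q, A.Tangent q) : ∀ q, A.Tangent q :=
  fun q => 𝒥.J q (a q)

/-- `Ω : TC ⊕ TC → TC` is the torsion of `J`: it is smooth (expressed in the bundle charts
`(x, w₁, w₂)` of `TC ⊕ TC`), and `Ω(a, b) = J[Ja, b] + J[a, Jb] + [a, b] - [Ja, Jb]` for all locally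
defined smooth vector fields `a`, `b`. -/
structure IsTorsion (𝒥 : A.AlmostComplex)
    (Ω : ∀ p, A.Tangent p → A.Tangent p → A.Tangent p) : Prop where
  smooth : ∀ p, ContDiffOn ℝ ∞
    (fun z : A.model p × A.model p × A.model p =>
      A.toCoord p ((A.chart p).symm z.1)
        (Ω ((A.chart p).symm z.1) (A.ofCoord p ((A.chart p).symm z.1) z.2.1)
          (A.ofCoord p ((A.chart p).symm z.1) z.2.2)))
    ((A.chart p).target ×ˢ univ)
  apply_field : ∀ (U : Set C), IsOpen U → ∀ a b : ∀ q, A.Tangent q,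
    A.SmoothFieldOn a U → A.SmoothFieldOn b U → ∀ p ∈ U,
      Ω p (a p) (b p) =
        𝒥.J p (A.bracket (𝒥.mapField a) b p) + 𝒥.J p (A.bracket a (𝒥.mapField b) p) +
          A.bracket a b p - A.bracket (𝒥.mapField a) (𝒥.mapField b) p

/-- `J` is multiplication by `i` for the complex manifold structure `B`, under the identification
of the tangent spaces of `A` with those of `B`. -/
def IsMulI (𝒥 : A.AlmostComplex) (B : AnalyticAtlas.{u, v} ℂ C) : Prop :=
  ∀ (p : C) (w : A.Tangent p),
    A.tangentIdent B.underlyingReal p (𝒥.J p w) =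
      (Complex.I • (A.tangentIdent B.underlyingReal p w : B.Tangent p) : B.Tangent p)

end AlmostComplex

end AnalyticAtlas

end

/-!
# Integrability of real analytic almost complex structures on Banach manifolds

In a chart, all derivatives of the vector fields cancel in
`J[Ja, b] + J[a, Jb] + [a, b] - [Ja, Jb]`, and what remains is the Nijenhuis tensor of `J`
(`lieBracket_mapField_eq_nijenhuis`). Brackets are compatible with coordinate changes
(`AnalyticAtlas.toCoord_bracket`), so these local expressions define the torsion. It is unique
because every pair of tangent vectors extends to fields with constant coordinates.

If `J` comes from a complex structure, a complex chart `θ` satisfies `θ' J = i θ'`, and the symmetry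
of `θ''` makes the Nijenhuis tensor vanish (`nijenhuis_eq_zero_of_fderiv_comp`).

The converse is local: near every point of an open subset of a real Banach space `E` one has to find
a real analytic chart `ψ` into a complex Banach space with `ψ' J = i ψ'`. By analyticity, `J`
extends to a holomorphic field `K` of operators on the complexification of `E`, and the identities
`K ^ 2 = -1` and `nijenhuis K = 0` persist. The second one says that the antiholomorphic
distribution `ker (K + i)` is involutive (`exists_complexified_structure`). The holomorphic Frobenius
theorem then provides a holomorphic map `φ` that is constant along the leaves, so that `φ' (K v - i v) = 0`, and
whose derivative at the base point is the projection onto `ker (K - i)` (`exists_intertwining`). Its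
restriction to `E` is the chart sought (`exists_holomorphic_chart`), since `E` is complementary to
the distribution. The
Frobenius theorem is proved by following rays inside the leaves: the implicit function theorem in
the space of continuous curves gives solutions that depend analytically on the ray, and
involutivity identifies their derivatives with respect to it (`exists_straightening_of_involutive`).

Coordinate changes between the charts so obtained are real analytic with complex-linear derivatives,
and such maps are holomorphic (`AnalyticAt.complex_of_real`).
-/

noncomputable section

open Filter Topology Metric

/-! ### Complexification of a real Banach space -/

/-- The complexification of a real Banach space `E`, realised as the space of real-linear operators
`ℂ → E`, on which `ℂ` acts by precomposition with multiplication. The vector `x + i y` corresponds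
to `c ↦ Re c • x - Im c • y`. With this model the operator norm satisfies `‖c • z‖ = ‖c‖ * ‖z‖` for
complex `c`, which the maximum norm on `E × E` does not. -/
def Complexified (E : Type*) [NormedAddCommGroup E] [NormedSpace ℝ E] : Type _ := ℂ →L[ℝ] E

namespace Complexified

section Basic

variable {E : Type*} [NormedAddCommGroup E] [NormedSpace ℝ E]

instance : NormedAddCommGroup (Complexified E) :=
  inferInstanceAs (NormedAddCommGroup (ℂ →L[ℝ] E))

instance [CompleteSpace E] : CompleteSpace (Complexified E) :=
  inferInstanceAs (CompleteSpace (ℂ →L[ℝ] E))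

/-- The operator `ℂ → E` underlying an element of the complexification. -/
def toCLM (z : Complexified E) : ℂ →L[ℝ] E := z

/-- The element of the complexification given by an operator `ℂ → E`. -/
def ofCLM (z : ℂ →L[ℝ] E) : Complexified E := z

lemma norm_toCLM_apply_le (z : Complexified E) (w : ℂ) : ‖z.toCLM w‖ ≤ ‖z‖ * ‖w‖ :=
  z.toCLM.le_opNorm w

instance : SMul ℂ (Complexified E) :=
  ⟨fun c z => ofCLM (z.toCLM.comp (ContinuousLinearMap.mul ℝ ℂ c))⟩

lemma toCLM_smul (c : ℂ) (z : Complexified E) (w : ℂ) : (c • z).toCLM w = z.toCLM (c * w) := rfl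
lemma toCLM_add (z z' : Complexified E) (w : ℂ) :
    (z + z').toCLM w = z.toCLM w + z'.toCLM w := rfl

@[ext] lemma ext {z z' : Complexified E} (h : ∀ w, z.toCLM w = z'.toCLM w) : z = z' :=
  ContinuousLinearMap.ext h

instance : Module ℂ (Complexified E) where
  one_smul z := by ext w; simp [toCLM_smul]
  mul_smul a b z := by ext w; simp only [toCLM_smul]; congr 1; ring
  smul_zero a := rfl
  smul_add a z z' := rfl
  add_smul a b z := by ext w; simp [toCLM_smul, toCLM_add, add_mul]
  zero_smul z := by
    ext w; rw [toCLM_smul, zero_mul, map_zero]; rfl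

instance : NormedSpace ℂ (Complexified E) where
  norm_smul_le c z := by
    refine ContinuousLinearMap.opNorm_le_bound _ (by positivity) fun w => ?_
    calc ‖z.toCLM (c * w)‖ ≤ ‖z‖ * ‖c * w‖ := norm_toCLM_apply_le _ _
      _ = ‖c‖ * ‖z‖ * ‖w‖ := by rw [norm_mul]; ring

lemma toCLM_real_smul (c : ℝ) (z : Complexified E) (w : ℂ) :
    (c • z).toCLM w = c • z.toCLM w := by
  have : c • z = (c : ℂ) • z := (Complex.coe_smul c z).symm
  rw [this, toCLM_smul, ← map_smul]; simp

/-- The inclusion `x ↦ x + i 0` of a real Banach space in its complexification. -/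
def ofReal : E →L[ℝ] Complexified E :=
  LinearMap.mkContinuous
    { toFun := fun x => ofCLM (Complex.reCLM.smulRight x)
      map_add' := fun x y => by ext w; exact smul_add _ _ _
      map_smul' := fun c x => by
        ext w; rw [RingHom.id_apply, toCLM_real_smul]; exact smul_comm _ _ _ }
    1 fun x => by
      rw [one_mul]
      refine ContinuousLinearMap.opNorm_le_bound _ (by positivity) fun w => ?_
      change ‖w.re • x‖ ≤ _
      rw [norm_smul, mul_comm]; gcongr; exact Complex.abs_re_le_norm w

lemma toCLM_ofReal (x : E) (w : ℂ) : (ofReal x).toCLM w = w.re • x := rfl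

/-- The real part `x` of `x + i y`. -/
def re : Complexified E →L[ℝ] E :=
  LinearMap.mkContinuous
    { toFun := fun z => z.toCLM 1
      map_add' := fun x y => rfl
      map_smul' := fun c x => toCLM_real_smul c x 1 }
    1 fun z => by
      rw [one_mul]; exact (norm_toCLM_apply_le z 1).trans_eq (by simp)

/-- The imaginary part `y` of `x + i y`. -/
def im : Complexified E →L[ℝ] E :=
  LinearMap.mkContinuous
    { toFun := fun z => - z.toCLM Complex.I
      map_add' := fun x y => by simp [toCLM_add, add_comm]
      map_smul' := fun c x => by simp [toCLM_real_smul] }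
    1 fun z => by simpa [mul_comm] using norm_toCLM_apply_le z Complex.I

lemma re_apply (z : Complexified E) : re z = z.toCLM 1 := rfl
lemma im_apply (z : Complexified E) : im z = - z.toCLM Complex.I := rfl

lemma norm_re_le (z : Complexified E) : ‖re z‖ ≤ ‖z‖ := by
  simpa [re_apply] using norm_toCLM_apply_le z 1

lemma norm_im_le (z : Complexified E) : ‖im z‖ ≤ ‖z‖ := by
  simpa [im_apply] using norm_toCLM_apply_le z Complex.I

lemma norm_ofReal_le (x : E) : ‖ofReal x‖ ≤ ‖x‖ := by
  refine ContinuousLinearMap.opNorm_le_bound _ (by positivity) fun w => ?_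
  change ‖w.re • x‖ ≤ _
  rw [norm_smul, mul_comm]; gcongr; exact Complex.abs_re_le_norm w

@[simp] lemma re_ofReal (x : E) : re (ofReal x) = x := by simp [re_apply, toCLM_ofReal]
@[simp] lemma im_ofReal (x : E) : im (ofReal x) = 0 := by simp [im_apply, toCLM_ofReal]
@[simp] lemma re_I_smul (z : Complexified E) : re (Complex.I • z) = - im z := by
  simp [re_apply, im_apply, toCLM_smul]
@[simp] lemma im_I_smul (z : Complexified E) : im (Complex.I • z) = re z := by
  simp [re_apply, im_apply, toCLM_smul]

lemma ext_re_im {z z' : Complexified E} (hr : re z = re z') (hi : im z = im z') : z = z' := by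
  ext w
  have h (z : Complexified E) : z.toCLM w = w.re • re z - w.im • im z := by
    have hw : w = w.re • (1 : ℂ) + w.im • Complex.I := by simp
    conv_lhs => rw [hw]
    rw [re_apply, im_apply, map_add, map_smul, map_smul, smul_neg, sub_neg_eq_add]
  rw [h, h, hr, hi]

lemma eq_re_add_im (z : Complexified E) : z = ofReal (re z) + Complex.I • ofReal (im z) :=
  ext_re_im (by simp) (by simp)

end Basic

section Lift

variable {E : Type*} [NormedAddCommGroup E] [NormedSpace ℝ E]
  {W : Type*} [NormedAddCommGroup W] [NormedSpace ℝ W] [NormedSpace ℂ W] [IsScalarTower ℝ ℂ W]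

/-- The `ℂ`-linear extension of a real-linear operator. -/
def extend (L : E →L[ℝ] W) : Complexified E →L[ℂ] W :=
  LinearMap.mkContinuous
    { toFun := fun z => L (re z) + Complex.I • L (im z)
      map_add' := fun x y => by simp only [map_add, smul_add]; abel
      map_smul' := fun c z => by
        have hc : c • z = c.re • z + c.im • (Complex.I • z) := by
          conv_lhs => rw [← Complex.re_add_im c, add_smul, mul_smul]
          rw [Complex.coe_smul, Complex.coe_smul]
        have hw (w : W) : c • w = c.re • w + c.im • (Complex.I • w) := by
          conv_lhs => rw [← Complex.re_add_im c, add_smul, mul_smul]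
          rw [← algebraMap_smul ℂ c.re w, ← algebraMap_smul ℂ c.im (Complex.I • w)]; rfl
        rw [hc, RingHom.id_apply, hw]
        simp only [map_add, map_smul, re_I_smul, im_I_smul, map_neg, smul_add, smul_neg,
          smul_comm Complex.I, smul_smul Complex.I, Complex.I_mul_I, neg_smul, one_smul]
        abel }
    (2 * ‖L‖) fun z => by
      calc ‖L (re z) + Complex.I • L (im z)‖ ≤ ‖L (re z)‖ + ‖L (im z)‖ := by
            refine (norm_add_le _ _).trans ?_
            rw [norm_smul, Complex.norm_I, one_mul]
        _ ≤ ‖L‖ * ‖z‖ + ‖L‖ * ‖z‖ := by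
            gcongr
            · exact (L.le_opNorm _).trans (by gcongr; exact norm_re_le z)
            · exact (L.le_opNorm _).trans (by gcongr; exact norm_im_le z)
        _ = 2 * ‖L‖ * ‖z‖ := by ring

lemma extend_apply (L : E →L[ℝ] W) (z : Complexified E) :
    extend L z = L (re z) + Complex.I • L (im z) := rfl

@[simp] lemma extend_ofReal (L : E →L[ℝ] W) (x : E) : extend L (ofReal x) = L x := by
  simp [extend_apply]

lemma norm_extend_le (L : E →L[ℝ] W) : ‖extend L‖ ≤ 2 * ‖L‖ :=
  LinearMap.mkContinuous_norm_le _ (by positivity) _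

variable (E W) in
/-- The `ℂ`-linear extension of real-linear operators, as a real-linear operator. -/
def extendL : (E →L[ℝ] W) →L[ℝ] (Complexified E →L[ℂ] W) :=
  LinearMap.mkContinuous
    { toFun := extend
      map_add' := fun L M => by
        ext z; simp only [extend_apply, add_apply, smul_add]; abel
      map_smul' := fun c L => by
        ext z
        simp only [extend_apply, smul_apply, smul_add, RingHom.id_apply,
          smul_comm Complex.I] }
    2 norm_extend_le

@[simp] lemma extendL_apply (L : E →L[ℝ] W) : extendL E W L = extend L := rfl

end Lift

/-- A real multilinear map has a complex multilinear extension to the complexification, with norm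
growing by at most `2 ^ n`. The last variable is extended first, at the cost of replacing the values
in `W` by values in `Complexified E →L[ℂ] W`; this is why the induction is over all `W`. -/
lemma exists_multilinear_extension {E : Type u} [NormedAddCommGroup E] [NormedSpace ℝ E] (n : ℕ) :
    ∀ {W : Type u} [NormedAddCommGroup W] [NormedSpace ℝ W] [NormedSpace ℂ W]
      [IsScalarTower ℝ ℂ W] (p : E [×n]→L[ℝ] W),
      ∃ q : Complexified E [×n]→L[ℂ] W, ‖q‖ ≤ 2 ^ n * ‖p‖ ∧
        ∀ v : Fin n → E, q (fun i => ofReal (v i)) = p v := by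
  induction n with
  | zero =>
    intro W _ _ _ _ p
    refine ⟨ContinuousMultilinearMap.uncurry0 ℂ _ (p 0), by simp, fun v => ?_⟩
    rw [ContinuousMultilinearMap.uncurry0_apply]
    congr 1
    exact Subsingleton.elim _ _
  | succ n ih =>
    intro W _ _ _ _ p
    obtain ⟨q, hq, hqp⟩ := ih ((extendL E W).compContinuousMultilinearMap p.curryRight)
    refine ⟨q.uncurryRight, ?_, fun v => ?_⟩
    · rw [ContinuousMultilinearMap.uncurryRight_norm]
      refine hq.trans ?_
      have h1 : ‖(extendL E W).compContinuousMultilinearMap p.curryRight‖ ≤ 2 * ‖p‖ := by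
        refine (ContinuousLinearMap.norm_compContinuousMultilinearMap_le _ _).trans ?_
        rw [ContinuousMultilinearMap.curryRight_norm]
        gcongr
        exact LinearMap.mkContinuous_norm_le _ zero_le_two _
      calc _ ≤ 2 ^ n * (2 * ‖p‖) := by gcongr
        _ = _ := by ring
    · rw [ContinuousMultilinearMap.uncurryRight_apply]
      have := hqp (Fin.init v)
      change q (Fin.init fun i => ofReal (v i)) _ = _ at *
      rw [show (Fin.init fun i => ofReal (v i)) = fun i => ofReal (Fin.init v i) from rfl, this]
      simp only [ContinuousLinearMap.compContinuousMultilinearMap_coe, Function.comp_apply,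
        extendL_apply, extend_ofReal, ContinuousMultilinearMap.curryRight_apply, Fin.snoc_init_self]

/-- A real analytic germ extends to a complex analytic germ on the complexification: extend its
power series term by term. -/
lemma exists_analyticAt_extension {E W : Type u} [NormedAddCommGroup E] [NormedSpace ℝ E]
    [NormedAddCommGroup W] [NormedSpace ℝ W] [NormedSpace ℂ W] [IsScalarTower ℝ ℂ W]
    [CompleteSpace W] {f : E → W} {x₀ : E} (hf : AnalyticAt ℝ f x₀) :
    ∃ g : Complexified E → W, AnalyticAt ℂ g (ofReal x₀) ∧ ∀ᶠ x in 𝓝 x₀, g (ofReal x) = f x := by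
  obtain ⟨p, r, hp⟩ := hf
  choose q hq hqp using fun n => exists_multilinear_extension n (p n)
  let Q : FormalMultilinearSeries ℂ (Complexified E) W := q
  obtain ⟨C, s, hC, hs, hCs⟩ := p.le_mul_pow_of_radius_pos (hp.r_pos.trans_le hp.r_le)
  have hrad : 0 < Q.radius := by
    let t : NNReal := ⟨(2 * s)⁻¹, by positivity⟩
    have ht : 0 < t := by
      change (0 : ℝ) < (2 * s)⁻¹
      positivity
    refine lt_of_lt_of_le (by exact_mod_cast ht) (Q.le_radius_of_bound C (r := t) fun n => ?_)
    calc ‖Q n‖ * (t : ℝ) ^ n ≤ (2 ^ n * (C * s ^ n)) * ((2 * s)⁻¹) ^ n := by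
          gcongr
          · exact (hq n).trans (by gcongr; exact hCs n)
          · exact le_rfl
      _ = C * ((2 * s) * (2 * s)⁻¹) ^ n := by rw [mul_pow (2 * s), mul_pow 2]; ring
      _ ≤ C := by rw [mul_inv_cancel₀ (by positivity)]; simp
  refine ⟨fun z => Q.sum (z - ofReal x₀), ?_, ?_⟩
  · have h0 : AnalyticAt ℂ Q.sum (ofReal x₀ - ofReal x₀) := by
      rw [sub_self]; exact (Q.hasFPowerSeriesOnBall hrad).analyticAt
    exact h0.comp (f := fun z => z - ofReal x₀) (by fun_prop)
  · filter_upwards [Metric.eball_mem_nhds x₀ hp.r_pos] with x hx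
    have h1 := hp.hasSum_sub hx
    rw [← h1.tsum_eq, FormalMultilinearSeries.sum]
    congr 1
    ext n
    rw [← map_sub]
    exact hqp n _

/-- Identity theorem: a family of holomorphic maps that vanishes at the real points near `x₀`
vanishes near `x₀`. The neighbourhood does not depend on the member of the family. -/
lemma eventually_forall_eq_zero_of_ofReal {E : Type*} [NormedAddCommGroup E] [NormedSpace ℝ E]
    {W : Type*} [NormedAddCommGroup W] [NormedSpace ℂ W] [CompleteSpace W]
    {ι : Type*} {g : ι → Complexified E → W} {x₀ : E}
    (hg : ∀ᶠ z in 𝓝 (ofReal x₀), ∀ i, DifferentiableAt ℂ (g i) z)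
    (h0 : ∀ᶠ x in 𝓝 x₀, ∀ i, g i (ofReal x) = 0) : ∀ᶠ z in 𝓝 (ofReal x₀), ∀ i, g i z = 0 := by
  obtain ⟨r, hr, hrg⟩ := Metric.eventually_nhds_iff_ball.1 hg
  obtain ⟨s, hs, hs0⟩ := Metric.eventually_nhds_iff_ball.1 h0
  refine Metric.eventually_nhds_iff_ball.2 ⟨min r s / 4, by positivity, fun z hz i => ?_⟩
  have hm : 0 < min r s := by positivity
  rw [mem_ball_iff_norm] at hz
  set x := re z
  set y := im z
  have hx : ‖x - x₀‖ < min r s / 4 := by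
    have := norm_re_le (z - ofReal x₀)
    rw [map_sub, re_ofReal] at this
    exact this.trans_lt hz
  have hy : ‖y‖ < min r s / 4 := by
    have := norm_im_le (z - ofReal x₀)
    rw [map_sub, im_ofReal, sub_zero] at this
    exact this.trans_lt hz
  -- The complex line through `z = x + i y` that meets the real subspace along `x + ℝ y`. The choice
  -- of the radius keeps its points with parameter in the disc of radius `2`, which contains `i`, in
  -- the domain of `g`.
  let l : ℂ → Complexified E := fun c => ofReal x + c • ofReal y
  have hl : Differentiable ℂ l := by fun_prop
  have hlr : ∀ c ∈ ball (0 : ℂ) 2, DifferentiableAt ℂ (g i ∘ l) c := by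
    intro c hc
    refine (hrg _ ?_ i).comp c (hl c)
    rw [mem_ball_zero_iff] at hc
    rw [mem_ball_iff_norm]
    calc ‖l c - ofReal x₀‖ = ‖ofReal (x - x₀) + c • ofReal y‖ := by
          simp only [l, map_sub]; congr 1; abel
      _ ≤ ‖x - x₀‖ + ‖c‖ * ‖y‖ := by
          refine (norm_add_le _ _).trans ?_
          rw [norm_smul]
          gcongr <;> exact norm_ofReal_le _
      _ ≤ ‖x - x₀‖ + 2 * ‖y‖ := by gcongr
      _ < r := by linarith [min_le_left r s]
  have han : AnalyticOnNhd ℂ (g i ∘ l) (ball 0 2) :=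
    DifferentiableOn.analyticOnNhd (fun c hc => (hlr c hc).differentiableWithinAt) isOpen_ball
  have hreal : ∀ t : ℝ, |t| < 2 → (g i ∘ l) t = 0 := by
    intro t ht
    have : l t = ofReal (x + t • y) := by
      simp only [l, map_add, map_smul]; rfl
    rw [Function.comp_apply, this]
    refine hs0 _ ?_ i
    rw [mem_ball_iff_norm]
    calc ‖x + t • y - x₀‖ = ‖(x - x₀) + t • y‖ := by congr 1; abel
      _ ≤ ‖x - x₀‖ + |t| * ‖y‖ := by
          refine (norm_add_le _ _).trans ?_
          rw [norm_smul, Real.norm_eq_abs]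
      _ ≤ ‖x - x₀‖ + 2 * ‖y‖ := by gcongr
      _ < s := by linarith [min_le_right r s]
  have hfreq : ∃ᶠ c in 𝓝[≠] (0 : ℂ), (g i ∘ l) c = (fun _ => (0 : W)) c := by
    have htend : Tendsto (fun t : ℝ => (t : ℂ)) (𝓝[≠] 0) (𝓝[≠] 0) := by
      refine tendsto_nhdsWithin_of_tendsto_nhds_of_eventually_within _ ?_ ?_
      · exact (Complex.continuous_ofReal.tendsto' 0 0 (by simp)).mono_left nhdsWithin_le_nhds
      · filter_upwards [self_mem_nhdsWithin] with t ht
        simpa using ht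
    refine htend.frequently (Eventually.frequently ?_)
    filter_upwards [nhdsWithin_le_nhds (Metric.ball_mem_nhds (0 : ℝ) two_pos)] with t ht
    exact hreal t (by simpa using ht)
  have hz' := han.eqOn_of_preconnected_of_frequently_eq analyticOnNhd_const
    (convex_ball (0 : ℂ) 2).isPreconnected (by simp) hfreq (x := Complex.I) (by simp)
  have : l Complex.I = z := (eq_re_add_im z).symm
  simpa [this] using hz'

lemma eventuallyEq_of_ofReal {E : Type*} [NormedAddCommGroup E] [NormedSpace ℝ E]
    {W : Type*} [NormedAddCommGroup W] [NormedSpace ℂ W] [CompleteSpace W]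
    {f g : Complexified E → W} {x₀ : E} (hf : ∀ᶠ z in 𝓝 (ofReal x₀), DifferentiableAt ℂ f z)
    (hg : ∀ᶠ z in 𝓝 (ofReal x₀), DifferentiableAt ℂ g z)
    (h0 : ∀ᶠ x in 𝓝 x₀, f (ofReal x) = g (ofReal x)) : f =ᶠ[𝓝 (ofReal x₀)] g := by
  have := eventually_forall_eq_zero_of_ofReal (ι := Unit) (g := fun _ => f - g) (x₀ := x₀)
    (by filter_upwards [hf, hg] with z h h' _ using h.sub h')
    (by filter_upwards [h0] with x hx; simp [hx])
  filter_upwards [this] with z hz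
  exact sub_eq_zero.1 (hz ())

end Complexified

/-- A real-linear operator commuting with multiplication by `i`, as a complex-linear operator. -/
def ContinuousLinearMap.toComplex {E W : Type*} [NormedAddCommGroup E] [NormedSpace ℂ E]
    [NormedAddCommGroup W] [NormedSpace ℂ W] (L : E →L[ℝ] W)
    (hL : ∀ v, L (Complex.I • v) = Complex.I • L v) : E →L[ℂ] W where
  toFun := L
  map_add' := map_add L
  map_smul' c v := by
    rw [← Complex.re_add_im c, RingHom.id_apply, add_smul, add_smul, mul_smul, mul_smul,
      Complex.coe_smul, Complex.coe_smul, Complex.coe_smul, Complex.coe_smul, map_add, map_smul,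
      map_smul, hL]
  cont := L.cont

open Complexified in
/-- A real analytic map between complex Banach spaces whose real derivatives are `ℂ`-linear is
complex analytic. If `g` is the extension of `f` to the complexification of `E` and `π (x + i y)` is
the vector `x + i y` computed in the complex space `E`, then `g = f ∘ π` by the identity theorem,
and `f` is recovered as the composition of `g` with a complex affine right inverse of `π`. -/
lemma AnalyticAt.complex_of_real {E W : Type u} [NormedAddCommGroup E] [NormedSpace ℂ E]
    [NormedAddCommGroup W] [NormedSpace ℂ W] [CompleteSpace W] {f : E → W} {x₀ : E}
    (hf : AnalyticAt ℝ f x₀)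
    (hI : ∀ᶠ x in 𝓝 x₀, ∀ v, fderiv ℝ f x (Complex.I • v) = Complex.I • fderiv ℝ f x v) :
    AnalyticAt ℂ f x₀ := by
  have hd : ∀ᶠ x in 𝓝 x₀, DifferentiableAt ℂ f x := by
    filter_upwards [hI, hf.eventually_analyticAt] with x hx hfx
    exact (hasFDerivAt_of_restrictScalars ℝ (f' := (fderiv ℝ f x).toComplex hx)
      hfx.differentiableAt.hasFDerivAt rfl).differentiableAt
  obtain ⟨g, hg, hgf⟩ := exists_analyticAt_extension hf
  let π : Complexified E →L[ℂ] E := extend (ContinuousLinearMap.id ℝ E)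
  have hπ (x : E) : π (ofReal x) = x := by simp [π]
  let mulI : E →L[ℝ] E := (Complex.I • ContinuousLinearMap.id ℂ E).restrictScalars ℝ
  let K : E →L[ℝ] Complexified E :=
    (2⁻¹ : ℝ) • (ofReal - Complex.I • ofReal.comp mulI)
  have hK (v : E) : K v = (2⁻¹ : ℝ) • (ofReal v - Complex.I • ofReal (Complex.I • v)) := rfl
  let κ : E →L[ℂ] Complexified E := K.toComplex fun v => by
    rw [hK, hK, smul_comm Complex.I (2⁻¹ : ℝ)]
    congr 1
    rw [smul_smul, Complex.I_mul_I, neg_smul, one_smul, map_neg, smul_neg, smul_sub, smul_smul,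
      Complex.I_mul_I, neg_smul, one_smul]
    abel
  have hκ (v : E) : κ v = (2⁻¹ : ℝ) • (ofReal v - Complex.I • ofReal (Complex.I • v)) := rfl
  have hπκ (v : E) : π (κ v) = v := by
    have h2 (c : ℝ) (z : Complexified E) : π (c • z) = c • π z :=
      (π.restrictScalars ℝ).map_smul c z
    rw [hκ, h2, map_sub, map_smul, hπ, hπ, smul_smul, Complex.I_mul_I, neg_smul, one_smul,
      sub_neg_eq_add, ← two_smul ℝ, smul_smul]
    norm_num
  have heq : g =ᶠ[𝓝 (ofReal x₀)] f ∘ π := by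
    refine eventuallyEq_of_ofReal ?_ ?_ ?_
    · filter_upwards [hg.eventually_analyticAt] with z hz using hz.differentiableAt
    · have : Tendsto π (𝓝 (ofReal x₀)) (𝓝 x₀) := by
        have := π.continuous.tendsto (ofReal x₀)
        rwa [hπ] at this
      filter_upwards [this.eventually hd] with z hz
      exact hz.comp z π.differentiableAt
    · filter_upwards [hgf] with x hx
      rw [hx, Function.comp_apply, hπ]
  have hκ' : AnalyticAt ℂ (fun x => ofReal x₀ + κ (x - x₀)) x₀ :=
    analyticAt_const.add
      ((κ.analyticAt _).comp (f := fun x => x - x₀) (analyticAt_id.sub analyticAt_const))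
  have hκ0 : ofReal x₀ + κ (x₀ - x₀) = ofReal x₀ := by simp
  have hcomp : AnalyticAt ℂ (fun x => g (ofReal x₀ + κ (x - x₀))) x₀ :=
    AnalyticAt.comp (g := g) (f := fun x => ofReal x₀ + κ (x - x₀)) (by rwa [hκ0]) hκ'
  refine hcomp.congr ?_
  have htend : Tendsto (fun x => ofReal x₀ + κ (x - x₀)) (𝓝 x₀) (𝓝 (ofReal x₀)) := by
    have := hκ'.continuousAt.tendsto
    rwa [hκ0] at this
  filter_upwards [htend.eventually heq] with x hx
  rw [hx, Function.comp_apply, map_add, hπκ, hπ, add_sub_cancel]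

/-! ### Superposition operators and primitives on spaces of curves -/

section Superposition

variable {𝕜 : Type*} [NontriviallyNormedField 𝕜] {K : Type*} [TopologicalSpace K] [CompactSpace K]
  {X : Type*} [NormedAddCommGroup X] [NormedSpace 𝕜 X]
  {Y : Type*} [NormedAddCommGroup Y] [NormedSpace 𝕜 Y]

/-- The pointwise application of a continuous multilinear map to continuous functions on a compact
space `K`, as a continuous multilinear map between spaces of continuous functions. -/
def ContinuousMultilinearMap.pointwise (K : Type*) [TopologicalSpace K] [CompactSpace K] {n : ℕ}
    (p : X [×n]→L[𝕜] Y) : C(K, X) [×n]→L[𝕜] C(K, Y) :=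
  MultilinearMap.mkContinuous
    { toFun := fun γ => ⟨fun t => p fun i => γ i t, by fun_prop⟩
      map_update_add' := fun {_} γ i a b => by
        ext t
        have h (c : C(K, X)) : (fun j => Function.update γ i c j t) =
            Function.update (fun j => γ j t) i (c t) := by
          ext j; by_cases hj : j = i <;> [(subst hj; simp); simp [hj]]
        simp only [ContinuousMap.coe_mk, ContinuousMap.add_apply, h, p.map_update_add]
      map_update_smul' := fun {_} γ i a b => by
        ext t
        have h (c : C(K, X)) : (fun j => Function.update γ i c j t) =
            Function.update (fun j => γ j t) i (c t) := by
          ext j; by_cases hj : j = i <;> [(subst hj; simp); simp [hj]]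
        simp only [ContinuousMap.coe_mk, ContinuousMap.smul_apply, h, p.map_update_smul] }
    ‖p‖ fun γ => by
      refine (ContinuousMap.norm_le _ (by positivity)).2 fun t => (p.le_opNorm _).trans ?_
      gcongr with i
      exact (γ i).norm_coe_le_norm t

lemma ContinuousMultilinearMap.norm_pointwise_le {n : ℕ} (p : X [×n]→L[𝕜] Y) :
    ‖p.pointwise K‖ ≤ ‖p‖ :=
  MultilinearMap.mkContinuous_norm_le _ (norm_nonneg p) _

variable (K) in
/-- The superposition operator `γ ↦ f ∘ γ` of an analytic germ `f` is analytic near the zero curve.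
Since `f` is controlled only near `0`, the operator is the sum of the pointwise power series of `f`,
and agrees with `γ ↦ f ∘ γ` for small `γ`. -/
lemma exists_analyticAt_superposition [CompleteSpace Y] {f : X → Y} (hf : AnalyticAt 𝕜 f 0) :
    ∃ N : C(K, X) → C(K, Y), AnalyticAt 𝕜 N 0 ∧ ∀ᶠ γ in 𝓝 0, ∀ t, N γ t = f (γ t) := by
  obtain ⟨p, r, hp⟩ := hf
  let Q : FormalMultilinearSeries 𝕜 C(K, X) C(K, Y) := fun n => (p n).pointwise K
  have hrad : 0 < Q.radius := by
    obtain ⟨C, s, hC, hs, hCs⟩ := p.le_mul_pow_of_radius_pos (hp.r_pos.trans_le hp.r_le)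
    let t : NNReal := ⟨s⁻¹, by positivity⟩
    have ht : 0 < t := by
      change (0 : ℝ) < s⁻¹
      positivity
    refine lt_of_lt_of_le (by exact_mod_cast ht) (Q.le_radius_of_bound C (r := t) fun n => ?_)
    calc ‖Q n‖ * (t : ℝ) ^ n ≤ (C * s ^ n) * (s⁻¹) ^ n := by
          gcongr
          · exact (p n).norm_pointwise_le.trans (hCs n)
          · exact le_rfl
      _ = C * (s * s⁻¹) ^ n := by rw [mul_pow]; ring
      _ ≤ C := by rw [mul_inv_cancel₀ (by positivity)]; simp
  have hQ := Q.hasFPowerSeriesOnBall hrad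
  refine ⟨Q.sum, hQ.analyticAt, ?_⟩
  filter_upwards [Metric.eball_mem_nhds (0 : C(K, X)) hrad,
    Metric.eball_mem_nhds (0 : C(K, X)) hp.r_pos] with γ hγ hγ' t
  have h1 := (hQ.hasSum hγ).map (ContinuousMap.evalCLM 𝕜 t : C(K, Y) →L[𝕜] Y)
    (ContinuousMap.evalCLM 𝕜 t).continuous
  have h2 : HasSum (fun n => p n fun _ => γ t) (f (0 + γ t)) := by
    refine hp.hasSum ?_
    rw [mem_eball, edist_zero_right] at hγ' ⊢
    refine lt_of_le_of_lt ?_ hγ'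
    rw [← ofReal_norm, ← ofReal_norm]
    exact ENNReal.ofReal_le_ofReal (γ.norm_coe_le_norm t)
  rw [zero_add] at h1 h2
  exact h1.unique h2

end Superposition

section Primitive

open unitInterval

variable {Y : Type*} [NormedAddCommGroup Y] [NormedSpace ℂ Y]

omit [NormedSpace ℂ Y] in
lemma continuous_comp_projIcc (g : C(I, Y)) :
    Continuous fun s : ℝ => g (projIcc 0 1 zero_le_one s) :=
  g.continuous.comp continuous_projIcc

variable [CompleteSpace Y]

variable (Y) in
/-- The operator sending a continuous function `g` on the unit interval to `t ↦ ∫₀ᵗ g`. -/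
def primitive : C(I, Y) →L[ℂ] C(I, Y) :=
  LinearMap.mkContinuous
    { toFun := fun g => ⟨fun t => ∫ s in (0 : ℝ)..t, g (projIcc 0 1 zero_le_one s),
        (intervalIntegral.continuous_primitive
          (fun a b => (continuous_comp_projIcc g).intervalIntegrable a b) 0).comp
          continuous_subtype_val⟩
      map_add' := fun g h => by
        ext t
        exact intervalIntegral.integral_add ((continuous_comp_projIcc g).intervalIntegrable _ _)
          ((continuous_comp_projIcc h).intervalIntegrable _ _)
      map_smul' := fun c g => by
        ext t
        exact intervalIntegral.integral_smul c _ }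
    1 fun g => by
      rw [one_mul]
      refine (ContinuousMap.norm_le _ (norm_nonneg g)).2 fun t => ?_
      refine (intervalIntegral.norm_integral_le_of_norm_le_const (C := ‖g‖)
        fun s _ => g.norm_coe_le_norm _).trans ?_
      rw [sub_zero, abs_of_nonneg t.2.1]
      exact mul_le_of_le_one_right (norm_nonneg g) t.2.2

omit [CompleteSpace Y] in
lemma primitive_apply (g : C(I, Y)) (t : I) :
    primitive Y g t = ∫ s in (0 : ℝ)..t, g (projIcc 0 1 zero_le_one s) := rfl

end Primitive

/-! ### Integrating an involutive family of vector fields along rays -/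

section Flow

open unitInterval

/-- Operators close to an operator that vanishes have no nonzero fixed vectors. -/
lemma eventually_eq_zero_of_apply_eq_self {Z V : Type*} [TopologicalSpace Z] [NormedAddCommGroup V]
    [NormedSpace ℂ V] {A : Z → V →L[ℂ] V} {z₀ : Z} (hA : ContinuousAt A z₀) (h0 : A z₀ = 0) :
    ∀ᶠ z in 𝓝 z₀, ∀ δ, A z δ = δ → δ = 0 := by
  have h1 := hA.norm.tendsto
  rw [h0, norm_zero] at h1
  filter_upwards [h1.eventually (gt_mem_nhds one_pos)] with z hz δ hδ
  by_contra hne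
  have hpos := norm_pos_iff.2 hne
  have := (A z).le_opNorm δ
  rw [hδ] at this
  nlinarith

variable {X : Type*} [NormedAddCommGroup X] [NormedSpace ℂ X]
  {Y : Type*} [NormedAddCommGroup Y] [NormedSpace ℂ Y]

/-- The pairing `(w, T) ↦ (t ↦ B w (T t))` of a vector with a continuous function. -/
def pairPointwise (B : X →L[ℂ] Y →L[ℂ] X) : X →L[ℂ] C(I, Y) →L[ℂ] C(I, X) :=
  LinearMap.mkContinuous₂
    (LinearMap.mk₂ ℂ (fun w (T : C(I, Y)) => (⟨fun t => B w (T t), by fun_prop⟩ : C(I, X)))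
      (fun _ _ _ => by ext; simp) (fun _ _ _ => by ext; simp) (fun _ _ _ => by ext; simp)
      (fun _ _ _ => by ext; simp))
    ‖B‖ fun w T => by
      refine (ContinuousMap.norm_le _ (by positivity)).2 fun t => ?_
      refine (B.le_opNorm₂ w (T t)).trans ?_
      gcongr
      exact T.norm_coe_le_norm t

lemma pairPointwise_apply (B : X →L[ℂ] Y →L[ℂ] X) (w : X) (T : C(I, Y)) (t : I) :
    pairPointwise B w T t = B w (T t) := rfl

variable (X) in
/-- The inclusion of `X` in `C([0, 1], X)` as the space of constant curves. -/
def constCurve : X →L[ℂ] C(I, X) :=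
  LinearMap.mkContinuous
    { toFun := fun x => ContinuousMap.const I x
      map_add' := fun _ _ => rfl
      map_smul' := fun _ _ => rfl }
    1 fun x => by
      rw [one_mul]
      exact (ContinuousMap.norm_le _ (norm_nonneg x)).2 fun t => le_rfl

lemma constCurve_apply (x : X) (t : I) : constCurve X x t = x := rfl

variable [CompleteSpace X] [CompleteSpace Y]

/-- Let the vector fields `z ↦ B h (R z)`, for `h` in the range of the projection `P`, commute in
the sense of `hinv`. Then some germ `Φ` with derivative the identity at `0` carries the constant
fields `h ∈ range P` to these vector fields.

For a vector `w`, let `γ` be the solution of `γ' = B w (R γ)` with `γ 0 = w - P w`, and put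
`Φ w = γ 1`. The implicit function theorem, applied in the space of curves to the integrated
equation, gives a solution depending analytically on `w`. Its derivative `η` in a direction
`h ∈ range P` and the curve `ξ t = t • B h (R (γ t))` satisfy the same inhomogeneous linear integral
equation, by `hinv`; for small `w` that equation has only one solution, so `η 1 = ξ 1`.

The values `R z` lie in an arbitrary Banach space `Y` paired with `X`; in the application
`Y = X →L[ℂ] X`, and `B h T = T h`. -/
lemma exists_straightening_of_involutive {R : X → Y} {B : X →L[ℂ] Y →L[ℂ] X} {P : X →L[ℂ] X}
    (hR : AnalyticAt ℂ R 0) (hR0 : ∀ h, B h (R 0) = P h)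
    (hinv : ∀ᶠ z in 𝓝 0, ∀ h k, B k (fderiv ℂ R z (B h (R z))) = B h (fderiv ℂ R z (B k (R z)))) :
    ∃ Φ : X → X, AnalyticAt ℂ Φ 0 ∧ Φ 0 = 0 ∧ fderiv ℂ Φ 0 = ContinuousLinearMap.id ℂ X ∧
      ∀ᶠ w in 𝓝 0, ∀ h, P h = h → fderiv ℂ Φ w h = B h (R (Φ w)) := by
  obtain ⟨N, hN, hNR⟩ := exists_analyticAt_superposition I hR
  let S : C(I, X) → C(I, Y) := fun γ => primitive Y (N γ)
  have hS : AnalyticAt ℂ S 0 := ((primitive Y).analyticAt _).comp hN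
  let c := constCurve X
  let Q : X →L[ℂ] X := ContinuousLinearMap.id ℂ X - P
  let G : X × C(I, X) → C(I, X) := fun u => u.2 - c (Q u.1) - pairPointwise B u.1 (S u.2)
  have hG : AnalyticAt ℂ G (0, 0) := by
    have h1 : AnalyticAt ℂ (fun u : X × C(I, X) => S u.2) (0, 0) :=
      AnalyticAt.comp (g := S) (f := fun u : X × C(I, X) => u.2) hS analyticAt_snd
    have h2 : AnalyticAt ℂ (fun u : X × C(I, X) => pairPointwise B u.1 (S u.2)) (0, 0) :=
      ((pairPointwise B).analyticAt_bilinear _).comp (analyticAt_fst.prod h1)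
    have h3 : AnalyticAt ℂ (fun u : X × C(I, X) => c (Q u.1)) (0, 0) :=
      ((c.comp Q).analyticAt _).comp analyticAt_fst
    exact (analyticAt_snd.sub h3).sub h2
  have hG0 : G (0, 0) = 0 := by simp [G]
  have hGinr : fderiv ℂ G (0, 0) ∘L .inr ℂ X C(I, X) = .id ℂ _ := by
    have h1 : HasFDerivAt (fun γ : C(I, X) => G (0, γ))
        (fderiv ℂ G (0, 0) ∘L .inr ℂ X C(I, X)) 0 :=
      HasFDerivAt.comp (g := G) (f := fun γ : C(I, X) => ((0 : X), γ)) 0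
        hG.differentiableAt.hasFDerivAt (hasFDerivAt_prodMk_right (0 : X) (0 : C(I, X)))
    have h2 : (fun γ : C(I, X) => G (0, γ)) = id := by
      ext γ; simp [G]
    rw [h2] at h1
    exact h1.unique (hasFDerivAt_id _)
  have cd := hG.contDiffAt (n := ω)
  have hinvertible : (fderiv ℂ G (0, 0) ∘L .inr ℂ X C(I, X)).IsInvertible := by
    rw [hGinr]; exact ⟨.refl ℂ _, rfl⟩
  let ψ : X → C(I, X) := cd.implicitFunction (by simp) hinvertible
  have hψ : AnalyticAt ℂ ψ 0 :=
    (cd.contDiffAt_implicitFunction (by simp) hinvertible).analyticAt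
  have hψ0 : ψ 0 = 0 := cd.implicitFunction_apply_self (by simp) hinvertible
  have hψt : Tendsto ψ (𝓝 0) (𝓝 0) := by simpa [hψ0] using hψ.continuousAt.tendsto
  have hψeq : ∀ᶠ w in 𝓝 0, ψ w = c (Q w) + pairPointwise B w (S (ψ w)) := by
    filter_upwards [cd.eventually_apply_implicitFunction (by simp) hinvertible] with w hw
    rw [hG0] at hw
    exact sub_eq_zero.1 ((sub_sub _ _ _).symm.trans hw)
  -- The linearised integral equation for the derivative of `ψ` in the direction `h`.
  have hderiv : ∀ᶠ w in 𝓝 0, ∀ h, fderiv ℂ ψ w h = c (Q h) +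
      pairPointwise B w (fderiv ℂ S (ψ w) (fderiv ℂ ψ w h)) + pairPointwise B h (S (ψ w)) := by
    filter_upwards [hψeq.eventually_nhds, hψ.eventually_analyticAt,
      hψt.eventually hS.eventually_analyticAt] with w hw hψw hSw h
    have h1 : HasFDerivAt (fun w => S (ψ w)) (fderiv ℂ S (ψ w) ∘L fderiv ℂ ψ w) w :=
      hSw.differentiableAt.hasFDerivAt.comp w hψw.differentiableAt.hasFDerivAt
    have h2 := ((c ∘L Q).hasFDerivAt (x := w)).add ((pairPointwise B).hasFDerivAt.clm_apply h1)
    have h3 := (h2.congr_of_eventuallyEq hw).unique hψw.differentiableAt.hasFDerivAt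
    conv_lhs => rw [← h3]
    simp [add_assoc]
  -- The curve `ξ t = t • B h (R (ψ w t))` solves that equation without its first term, which
  -- vanishes for `P h = h`.
  have hξ : ∀ᶠ w in 𝓝 0, ∀ h, ∃ ξ : C(I, X), ξ 1 = B h (R (ψ w 1)) ∧ ξ =
      pairPointwise B w (fderiv ℂ S (ψ w) ξ) + pairPointwise B h (S (ψ w)) := by
    have hRψ : ∀ᶠ γ : C(I, X) in 𝓝 0, ∀ t, AnalyticAt ℂ R (γ t) ∧
        ∀ h k, B k (fderiv ℂ R (γ t) (B h (R (γ t)))) = B h (fderiv ℂ R (γ t) (B k (R (γ t)))) := by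
      obtain ⟨ε, hε, hb⟩ := Metric.eventually_nhds_iff_ball.1 (hR.eventually_analyticAt.and hinv)
      filter_upwards [Metric.ball_mem_nhds (0 : C(I, X)) hε] with γ hγ t
      refine hb _ ?_
      rw [mem_ball_zero_iff] at hγ ⊢
      exact (γ.norm_coe_le_norm t).trans_lt hγ
    filter_upwards [hψeq, hψt.eventually hRψ, hψt.eventually hNR.eventually_nhds,
      hψt.eventually hN.eventually_analyticAt] with w hw hRw hNw hNan h
    set γ := ψ w with hγ
    -- `g` extends the curve `γ` to a differentiable function on the whole real line.
    let g : ℝ → X := fun t => Q w + B w (∫ s in (0 : ℝ)..t, N γ (projIcc 0 1 zero_le_one s))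
    have hg (t : I) : g t = γ t := by
      conv_rhs => rw [hw]
      rfl
    have hgd (t : ℝ) : HasDerivAt g (B w (N γ (projIcc 0 1 zero_le_one t))) t := by
      refine HasDerivAt.const_add _ ?_
      refine ((B w).restrictScalars ℝ).hasFDerivAt.comp_hasDerivAt t ?_
      exact (continuous_comp_projIcc (N γ)).integral_hasStrictDerivAt 0 t |>.hasDerivAt
    let ξ : C(I, X) := ⟨fun t => (t : ℝ) • B h (N γ t), by fun_prop⟩
    have hξt (t : I) : ξ t = (t : ℝ) • B h (R (γ t)) := by
      rw [← hNw.self_of_nhds t]; rfl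
    have hDN (t : I) : fderiv ℂ N γ ξ t = fderiv ℂ R (γ t) (ξ t) := by
      have h1 : HasFDerivAt (fun δ : C(I, X) => N δ t)
          ((ContinuousMap.evalCLM ℂ t : C(I, Y) →L[ℂ] Y) ∘L fderiv ℂ N γ) γ :=
        (ContinuousMap.evalCLM ℂ t : C(I, Y) →L[ℂ] Y).hasFDerivAt.comp γ
          hNan.differentiableAt.hasFDerivAt
      have h2 : HasFDerivAt (fun δ : C(I, X) => R (δ t))
          (fderiv ℂ R (γ t) ∘L (ContinuousMap.evalCLM ℂ t : C(I, X) →L[ℂ] X)) γ :=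
        (hRw t).1.differentiableAt.hasFDerivAt.comp γ
          (ContinuousMap.evalCLM ℂ t : C(I, X) →L[ℂ] X).hasFDerivAt
      have h3 := (h2.congr_of_eventuallyEq (hNw.mono fun δ hδ => hδ t)).unique h1
      exact (congrArg (fun L => L ξ) h3).symm
    have hDS : fderiv ℂ S γ ξ = primitive Y (fderiv ℂ N γ ξ) := by
      have h1 : HasFDerivAt S (primitive Y ∘L fderiv ℂ N γ) γ :=
        (primitive Y).hasFDerivAt.comp γ hNan.differentiableAt.hasFDerivAt
      rw [h1.fderiv]; rfl
    refine ⟨ξ, by simp [hξt], ?_⟩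
    rw [hDS]
    ext t
    have hpair (k : X) (f : C(I, Y)) : pairPointwise B k (primitive Y f) t =
        ∫ s in (0 : ℝ)..t, B k (f (projIcc 0 1 zero_le_one s)) := by
      rw [pairPointwise_apply, primitive_apply]
      exact ((B k).intervalIntegral_comp_comm
        ((continuous_comp_projIcc f).intervalIntegrable _ _)).symm
    have hcont (k : X) (f : C(I, Y)) :
        Continuous fun s : ℝ => B k (f (projIcc 0 1 zero_le_one s)) :=
      (B k).continuous.comp (continuous_comp_projIcc f)
    rw [ContinuousMap.add_apply, hpair, hpair, ← intervalIntegral.integral_add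
      ((hcont _ _).intervalIntegrable _ _) ((hcont _ _).intervalIntegrable _ _)]
    have key := intervalIntegral.integral_eq_sub_of_hasDerivAt_of_le
      (f := fun s : ℝ => s • B h (N γ (projIcc 0 1 zero_le_one s)))
      (f' := fun s => B w (fderiv ℂ N γ ξ (projIcc 0 1 zero_le_one s)) +
        B h (N γ (projIcc 0 1 zero_le_one s))) t.2.1
      (continuous_id.smul (hcont h (N γ))).continuousOn ?_
      (((hcont _ _).add (hcont _ _)).intervalIntegrable _ _)
    · rw [key, zero_smul, sub_zero, projIcc_of_mem _ t.2]; rfl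
    · intro s hs
      have hsI : s ∈ I := ⟨hs.1.le, hs.2.le.trans t.2.2⟩
      have hnhds : ∀ᶠ s' in 𝓝 s, s' • B h (N γ (projIcc 0 1 zero_le_one s')) =
          s' • B h (R (g s')) := by
        filter_upwards [Ioo_mem_nhds hs.1 (hs.2.trans_le t.2.2)] with s' hs'
        have hs'I : s' ∈ I := ⟨hs'.1.le, hs'.2.le⟩
        rw [hNw.self_of_nhds, projIcc_of_mem _ hs'I, ← hg]
      rw [projIcc_of_mem _ hsI, hDN]
      have hgs : g s = γ ⟨s, hsI⟩ := hg ⟨s, hsI⟩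
      have hgds := hgd s
      rw [projIcc_of_mem _ hsI, hNw.self_of_nhds] at hgds
      have hRg : HasDerivAt (fun s => R (g s))
          (fderiv ℂ R (γ ⟨s, hsI⟩) (B w (R (γ ⟨s, hsI⟩)))) s := by
        refine HasFDerivAt.comp_hasDerivAt (l := R) s
          (l' := (fderiv ℂ R (γ ⟨s, hsI⟩)).restrictScalars ℝ) ?_ hgds
        rw [hgs]
        exact (hRw ⟨s, hsI⟩).1.differentiableAt.hasFDerivAt.restrictScalars ℝ
      have h5 := (hasDerivAt_id s).smul
        (((B h).restrictScalars ℝ).hasFDerivAt.comp_hasDerivAt s hRg)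
      refine (h5.congr_of_eventuallyEq hnhds).congr_deriv ?_
      -- Involutivity exchanges `w` and `h`.
      have h6 := (hRw ⟨s, hsI⟩).2 w h
      rw [hξt, hNw.self_of_nhds]
      have h7 (c : ℝ) (x : X) : fderiv ℂ R (γ ⟨s, hsI⟩) (c • x) = c • fderiv ℂ R (γ ⟨s, hsI⟩) x :=
        ((fderiv ℂ R (γ ⟨s, hsI⟩)).restrictScalars ℝ).map_smul c x
      have h8 (c : ℝ) (y : Y) : B w (c • y) = c • B w y := ((B w).restrictScalars ℝ).map_smul c y
      rw [h7, h8, ← h6, one_smul, Function.comp_apply, hgs]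
      rfl
  have hcontr : ∀ᶠ w in 𝓝 0, ∀ δ, (pairPointwise B w ∘L fderiv ℂ S (ψ w)) δ = δ → δ = 0 := by
    refine eventually_eq_zero_of_apply_eq_self ?_ (by simp)
    refine ContinuousAt.clm_comp (pairPointwise B).continuous.continuousAt ?_
    exact ContinuousAt.comp (by rw [hψ0]; exact hS.fderiv.continuousAt) hψ.continuousAt
  let e : C(I, X) →L[ℂ] X := ContinuousMap.evalCLM ℂ 1
  refine ⟨fun w => ψ w 1, ?_, ?_, ?_, ?_⟩
  · exact (e.analyticAt _).comp hψ
  · simp [hψ0]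
  · have h1 : HasFDerivAt (fun w => ψ w 1) (e ∘L fderiv ℂ ψ 0) 0 :=
      e.hasFDerivAt.comp 0 hψ.differentiableAt.hasFDerivAt
    rw [h1.fderiv]
    ext h
    have h2 := congrArg e (hderiv.self_of_nhds h)
    have h3 : N 0 = constCurve Y (R 0) := by
      ext t; exact hNR.self_of_nhds t
    have h4 : S 0 1 = R 0 := by
      simp [S, primitive_apply, h3, constCurve_apply]
    rw [map_zero, zero_apply, add_zero, map_add] at h2
    rw [ContinuousLinearMap.comp_apply, h2]
    change Q h + B h (S (ψ 0) 1) = h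
    rw [hψ0, h4, hR0]
    simp [Q]
  · filter_upwards [hderiv, hξ, hcontr, hψ.eventually_analyticAt] with w hw hξw hcw hψw h hh
    have h1 : HasFDerivAt (fun w => ψ w 1) (e ∘L fderiv ℂ ψ w) w :=
      e.hasFDerivAt.comp w hψw.differentiableAt.hasFDerivAt
    obtain ⟨ξ, hξ1, hξ2⟩ := hξw h
    rw [h1.fderiv, ← hξ1]
    have hη := hw h
    have hQ : Q h = 0 := by simp [Q, hh]
    rw [hQ, map_zero, zero_add] at hη
    have hδ : fderiv ℂ ψ w h - ξ =
        (pairPointwise B w ∘L fderiv ℂ S (ψ w)) (fderiv ℂ ψ w h - ξ) := by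
      conv_lhs => rw [hη, hξ2]
      simp
    have hz : fderiv ℂ ψ w h - ξ = 0 := hcw _ hδ.symm
    rw [← sub_eq_zero.1 hz]
    rfl

end Flow

/-! ### Holomorphic integration of the antiholomorphic distribution -/

section Straightening

variable {X : Type*} [NormedAddCommGroup X] [NormedSpace ℂ X] [CompleteSpace X]

lemma eventually_isUnit {A Z : Type*} [NormedRing A] [CompleteSpace A] [TopologicalSpace Z]
    {M : Z → A} {z₀ : Z} (hM : ContinuousAt M z₀) (h1 : M z₀ = 1) : ∀ᶠ z in 𝓝 z₀, IsUnit (M z) :=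
  hM.eventually (by rw [h1]; exact Units.isOpen.mem_nhds isUnit_one)

/-- For a projection-valued germ `P`, the range of `P z` is a graph over the range of `P 0`. The
operator `R z` sends a vector of the range of `P 0` to the vector of the range of `P z` that
projects to it under `P 0`. It is given by `R z = (M z)⁻¹ P 0`, where
`M z = P 0 P z + (1 - P 0) (1 - P z)` satisfies `M z P z = P 0 M z` and `M 0 = 1`. -/
lemma exists_transport {P : X → X →L[ℂ] X} (hP : AnalyticAt ℂ P 0)
    (hPP : ∀ᶠ z in 𝓝 0, P z * P z = P z) :
    ∃ R : X → X →L[ℂ] X, AnalyticAt ℂ R 0 ∧ R 0 = P 0 ∧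
      ∀ᶠ z in 𝓝 0, P z * R z = R z ∧ P 0 * R z = P 0 ∧ R z * P 0 = R z ∧ R z * P z = P z ∧
        ∀ m, P z m = m → P 0 m = 0 → m = 0 := by
  have hP0 : P 0 * P 0 = P 0 := hPP.self_of_nhds
  let M : X → X →L[ℂ] X := fun z => P 0 * P z + (1 - P 0) * (1 - P z)
  have hM : AnalyticAt ℂ M 0 :=
    (analyticAt_const.mul hP).add (analyticAt_const.mul (analyticAt_const.sub hP))
  have hM0 : M 0 = 1 := by
    simp only [M, mul_sub, sub_mul, one_mul, mul_one, hP0]; abel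
  refine ⟨fun z => Ring.inverse (M z) * P 0, ?_, by simp [hM0], ?_⟩
  · refine AnalyticAt.mul ?_ analyticAt_const
    refine AnalyticAt.comp (g := Ring.inverse) ?_ hM
    rw [hM0]
    exact analyticAt_inverse (𝕜 := ℂ) (1 : (X →L[ℂ] X)ˣ)
  · filter_upwards [hPP, eventually_isUnit hM.continuousAt hM0] with z hz hu
    have h1 : M z * P z = P 0 * P z := by
      simp only [M, add_mul, mul_assoc, sub_mul, one_mul, hz]; simp
    have h2 : P 0 * M z = P 0 * P z := by
      simp only [M, mul_add, ← mul_assoc, mul_sub, mul_one, hP0]; simp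
    have hl := Ring.inverse_mul_cancel _ hu
    have hr := Ring.mul_inverse_cancel _ hu
    have h3 : P z * Ring.inverse (M z) = Ring.inverse (M z) * P 0 := by
      calc P z * Ring.inverse (M z)
          = Ring.inverse (M z) * (M z * P z) * Ring.inverse (M z) := by
            rw [← mul_assoc, hl, one_mul]
        _ = Ring.inverse (M z) * (P 0 * (M z * Ring.inverse (M z))) := by
            rw [h1, ← h2]; simp only [mul_assoc]
        _ = _ := by rw [hr, mul_one]
    refine ⟨?_, ?_, ?_, ?_, fun m hm hm0 => ?_⟩
    · rw [← mul_assoc, h3, mul_assoc, hP0]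
    · rw [← h3, ← mul_assoc, ← h2, mul_assoc, hr, mul_one]
    · rw [mul_assoc, hP0]
    · rw [mul_assoc, ← h1, ← mul_assoc, hl, one_mul]
    · have h4 : M z m = 0 := by
        simp [M, hm, hm0]
      have h5 := congrArg (fun T : X →L[ℂ] X => T m) hl
      simpa [h4] using h5.symm

open Complex in
/-- Let `J` be a complex-linear almost complex structure whose antiholomorphic distribution
`ker (J z + i)` is involutive. Then there is a germ `φ` that is constant along this distribution,
that is, whose derivative intertwines `J z` with multiplication by `i`; its derivative at `0` is the
projection onto `ker (J 0 - i)` along `ker (J 0 + i)`. -/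
lemma exists_intertwining {J : X → X →L[ℂ] X} (hJ : AnalyticAt ℂ J 0)
    (hJJ : ∀ᶠ z in 𝓝 0, ∀ v, J z (J z v) = -v)
    (hint : ∀ᶠ z in 𝓝 0, ∀ a b, J z a = -(I • a) → J z b = -(I • b) →
      fderiv ℂ J z b a = fderiv ℂ J z a b) :
    ∃ φ : X → X, AnalyticAt ℂ φ 0 ∧
      (∀ v, fderiv ℂ φ 0 v = (2⁻¹ : ℂ) • (v - I • J 0 v)) ∧
      ∀ᶠ z in 𝓝 0, ∀ v, fderiv ℂ φ z (J z v) = I • fderiv ℂ φ z v := by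
  -- `P z` is the projection onto `ker (J z + i)` along `ker (J z - i)`.
  let P : X → X →L[ℂ] X := fun z => (2⁻¹ : ℂ) • (1 + I • J z)
  have hPv (z v : X) : P z v = (2⁻¹ : ℂ) • (v + I • J z v) := rfl
  have hII (x : X) : I • I • x = -x := by rw [smul_smul, I_mul_I, neg_one_smul]
  have hP : AnalyticAt ℂ P 0 := by
    change AnalyticAt ℂ ((2⁻¹ : ℂ) • ((fun _ => (1 : X →L[ℂ] X)) + I • J)) 0
    exact (analyticAt_const.add hJ.const_smul).const_smul
  have hPP : ∀ᶠ z in 𝓝 0, P z * P z = P z := by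
    filter_upwards [hJJ] with z hz
    ext v
    rw [mul_apply_eq_comp, hPv, hPv]
    simp only [map_add, map_smul, hz, smul_add, smul_comm I (2⁻¹ : ℂ), smul_neg, hII]
    module
  have hPJ : ∀ z v, P z v = v → J z v = -(I • v) := by
    intro z v h
    rw [hPv] at h
    have h1 : v + I • J z v = (2 : ℂ) • v := by
      conv_rhs => rw [← h]
      rw [smul_smul]; norm_num
    have h2 : I • J z v = v := by
      rw [two_smul] at h1; exact add_left_cancel h1
    conv_rhs => rw [← h2]
    rw [smul_smul, I_mul_I, neg_smul, one_smul, neg_neg]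
  obtain ⟨R, hR, hR0, hRz⟩ := exists_transport hP hPP
  have hdP : ∀ᶠ z in 𝓝 0, ∀ v w, fderiv ℂ P z v w = (2⁻¹ : ℂ) • I • fderiv ℂ J z v w := by
    filter_upwards [hJ.eventually_analyticAt] with z hz v w
    have h1 : HasFDerivAt P ((2⁻¹ : ℂ) • I • fderiv ℂ J z) z :=
      ((hz.differentiableAt.hasFDerivAt.const_smul I).const_add 1).const_smul (2⁻¹ : ℂ)
    rw [h1.fderiv]; rfl
  have hinv : ∀ᶠ z in 𝓝 0, ∀ h k, fderiv ℂ R z (R z h) k = fderiv ℂ R z (R z k) h := by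
    filter_upwards [hRz.eventually_nhds, hR.eventually_analyticAt, hP.eventually_analyticAt, hint,
      hdP] with z hz hRan hPan hint hdP h k
    obtain ⟨e1, e2, e3, e4, e5⟩ := hz.self_of_nhds
    have hd1 (v w : X) : P z (fderiv ℂ R z v w) + fderiv ℂ P z v (R z w) = fderiv ℂ R z v w := by
      have h1 := hPan.differentiableAt.hasFDerivAt.mul' hRan.differentiableAt.hasFDerivAt
      have h2 := (h1.congr_of_eventuallyEq (hz.mono fun y hy => hy.1.symm)).unique
        hRan.differentiableAt.hasFDerivAt
      exact congrArg (fun L => L v w) h2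
    have hd2 (v w : X) : P 0 (fderiv ℂ R z v w) = 0 := by
      have h1 := hRan.differentiableAt.hasFDerivAt.const_mul (P 0)
      have h2 := (h1.congr_of_eventuallyEq (hz.mono fun y hy => hy.2.1.symm)).unique
        (hasFDerivAt_const (P 0) z)
      exact congrArg (fun L => L v w) h2
    have hPR (h : X) : P z (R z h) = R z h := congrArg (fun L => L h) e1
    -- The bracket of the fields `R h` and `R k` lies in the range of `P z` by `hint`, and is
    -- annihilated by `P 0` because `P 0 (R z h)` does not depend on `z`. So it vanishes.
    refine sub_eq_zero.1 (e5 _ ?_ ?_)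
    · have hi := hint _ _ (hPJ z _ (hPR h)) (hPJ z _ (hPR k))
      have hi' : fderiv ℂ P z (R z h) (R z k) = fderiv ℂ P z (R z k) (R z h) := by
        rw [hdP, hdP, hi]
      have h3 := hd1 (R z h) k
      have h4 := hd1 (R z k) h
      rw [map_sub, eq_sub_of_add_eq h3, eq_sub_of_add_eq h4, hi']
      abel
    · rw [map_sub, hd2, hd2, sub_zero]
  obtain ⟨Φ, hΦ, hΦ0, hdΦ0, hdΦ⟩ := exists_straightening_of_involutive
    (B := ContinuousLinearMap.apply ℂ X) (P := P 0) hR (fun h => by rw [hR0]; rfl) (hinv.mono fun z hz h k => hz h k)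
  have hΦd : HasFDerivAt Φ ((ContinuousLinearEquiv.refl ℂ X : X ≃L[ℂ] X) : X →L[ℂ] X) 0 := by
    have := hΦ.differentiableAt.hasFDerivAt
    rwa [hdΦ0] at this
  have cd : ContDiffAt ℂ ω Φ 0 := hΦ.contDiffAt
  let e := cd.toOpenPartialHomeomorph Φ hΦd (by simp)
  have he0 : (0 : X) ∈ e.source := cd.mem_toOpenPartialHomeomorph_source hΦd (by simp)
  have heΦ : (e : X → X) = Φ := cd.toOpenPartialHomeomorph_coe hΦd (by simp)
  have hes0 : e.symm 0 = 0 := by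
    have := e.left_inv he0
    rwa [heΦ, hΦ0] at this
  have hes : AnalyticAt ℂ e.symm 0 := by
    have := e.analyticAt_symm' he0 (by rwa [heΦ]) (i := .refl ℂ X) (by rw [heΦ, hdΦ0]; rfl)
    rwa [heΦ, hΦ0] at this
  have het : ∀ᶠ z in 𝓝 (0 : X), z ∈ e.target := by
    refine e.open_target.mem_nhds ?_
    have := e.map_source he0
    rwa [heΦ, hΦ0] at this
  have hest : Tendsto e.symm (𝓝 0) (𝓝 0) := by
    have := hes.continuousAt.tendsto
    rwa [hes0] at this
  let Q : X →L[ℂ] X := 1 - P 0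
  have hQφ : ∀ᶠ z in 𝓝 0, HasFDerivAt (fun z => Q (e.symm z)) (Q ∘L fderiv ℂ e.symm z) z := by
    filter_upwards [hes.eventually_analyticAt] with z hz
    exact Q.hasFDerivAt.comp z hz.differentiableAt.hasFDerivAt
  have hdes : ∀ᶠ z in 𝓝 0, ∀ h, fderiv ℂ e.symm z (fderiv ℂ Φ (e.symm z) h) = h := by
    filter_upwards [het, hes.eventually_analyticAt, hest.eventually hΦ.eventually_analyticAt]
      with z hz hz' hz'' h
    have hzz : Φ (e.symm z) = z := by rw [← heΦ]; exact e.right_inv hz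
    have h1 : HasFDerivAt (fun w => e.symm (Φ w)) (fderiv ℂ e.symm z ∘L fderiv ℂ Φ (e.symm z))
        (e.symm z) := by
      refine HasFDerivAt.comp (g := e.symm) _ ?_ hz''.differentiableAt.hasFDerivAt
      rw [hzz]; exact hz'.differentiableAt.hasFDerivAt
    have h2 : (fun w => e.symm (Φ w)) =ᶠ[𝓝 (e.symm z)] id := by
      filter_upwards [e.open_source.mem_nhds (e.map_target hz)] with w hw
      rw [← heΦ]; exact e.left_inv hw
    exact congrArg (fun L => L h) ((h1.congr_of_eventuallyEq h2.symm).unique (hasFDerivAt_id _))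
  have hP0 : P 0 * P 0 = P 0 := hPP.self_of_nhds
  refine ⟨fun z => Q (e.symm z), (Q.analyticAt _).comp hes, fun v => ?_, ?_⟩
  · rw [hQφ.self_of_nhds.fderiv]
    have := hdes.self_of_nhds v
    rw [hes0, hdΦ0] at this
    rw [ContinuousLinearMap.comp_apply, show fderiv ℂ e.symm 0 v = v from this]
    change v - P 0 v = _
    rw [hPv]
    module
  · filter_upwards [hQφ, hdes, hest.eventually hdΦ, hRz, het, hJJ] with z hQz hz hΦz hRz hzt hJz v
    have hzz : Φ (e.symm z) = z := by rw [← heΦ]; exact e.right_inv hzt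
    rw [hQz.fderiv]
    obtain ⟨e1, e2, e3, e4, e5⟩ := hRz
    -- `J v - i v` lies in the range of `P z`, on which the derivative of `φ` vanishes.
    have hker (k : X) (hk : P z k = k) : (Q ∘L fderiv ℂ e.symm z) k = 0 := by
      have hk' : fderiv ℂ Φ (e.symm z) (P 0 k) = k := by
        rw [hΦz (P 0 k) (congrArg (fun L : X →L[ℂ] X => L k) hP0), hzz]
        change (R z * P 0) k = k
        rw [e3]
        conv_lhs => rw [← hk]
        change (R z * P z) k = k
        rw [e4, hk]
      rw [ContinuousLinearMap.comp_apply, ← hk', hz]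
      change P 0 k - (P 0 * P 0) k = 0
      rw [hP0, sub_self]
    have h1 := hker (J z v - I • v) (by
      rw [hPv, map_sub, map_smul, hJz]
      simp only [smul_sub, smul_neg, hII]
      module)
    rwa [map_sub, map_smul, sub_eq_zero] at h1

end Straightening

/-! ### The Nijenhuis tensor in a chart -/

section Nijenhuis

variable {E : Type*} [NormedAddCommGroup E] [NormedSpace ℝ E]

/-- The Nijenhuis tensor of a field `J` of operators on an open subset of a Banach space, evaluated
at the point `x` and on the vectors `a` and `b`. It is the torsion of `J` in coordinates: with
constant fields `a`, `b`, the brackets `[J a, b]`, `[a, J b]`, `[J a, J b]` reduce to derivatives of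
`J`. -/
def nijenhuis (J : E → E →L[ℝ] E) (x a b : E) : E :=
  J x (fderiv ℝ J x b a) - J x (fderiv ℝ J x a b) - fderiv ℝ J x (J x b) a + fderiv ℝ J x (J x a) b

/-- All terms with derivatives of the vector fields cancel in the bracket expression for the
torsion. The bracket `[a, b] = a' b - b' a` is `VectorField.lieBracket ℝ b a`, with the arguments
exchanged. -/
lemma lieBracket_mapField_eq_nijenhuis {J : E → E →L[ℝ] E} {a b : E → E} {x : E}
    (hJ : DifferentiableAt ℝ J x) (ha : DifferentiableAt ℝ a x) (hb : DifferentiableAt ℝ b x)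
    (hJJ : ∀ v, J x (J x v) = -v) :
    J x (VectorField.lieBracket ℝ b (fun y => J y (a y)) x) +
      J x (VectorField.lieBracket ℝ (fun y => J y (b y)) a x) + VectorField.lieBracket ℝ b a x -
      VectorField.lieBracket ℝ (fun y => J y (b y)) (fun y => J y (a y)) x =
    nijenhuis J x (a x) (b x) := by
  have h1 {c : E → E} (hc : DifferentiableAt ℝ c x) (v : E) :
      fderiv ℝ (fun y => J y (c y)) x v = fderiv ℝ J x v (c x) + J x (fderiv ℝ c x v) := by
    rw [(hJ.hasFDerivAt.clm_apply hc.hasFDerivAt).fderiv]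
    simp [add_comm]
  simp only [VectorField.lieBracket, h1 ha, h1 hb, map_sub, map_add, hJJ, nijenhuis]
  abel

/-- If `θ' J = i θ'` with `θ'` injective, then `θ' (J' v w) = i θ''(v, w) - θ''(v, J w)`, and the
Nijenhuis tensor vanishes by the symmetry of `θ''`. -/
lemma nijenhuis_eq_zero_of_fderiv_comp {F : Type*} [NormedAddCommGroup F] [NormedSpace ℂ F]
    {J : E → E →L[ℝ] E} {θ : E → F} {x : E} (hJ : DifferentiableAt ℝ J x)
    (hθ : ContDiffAt ℝ 2 θ x) (hinj : Function.Injective (fderiv ℝ θ x))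
    (hJθ : ∀ᶠ y in 𝓝 x, ∀ v, fderiv ℝ θ y (J y v) = Complex.I • fderiv ℝ θ y v) (a b : E) :
    nijenhuis J x a b = 0 := by
  have hdθ : DifferentiableAt ℝ (fderiv ℝ θ) x :=
    (hθ.fderiv_right (m := 1) (by norm_num)).differentiableAt one_ne_zero
  have hsymm : IsSymmSndFDerivAt ℝ θ x := hθ.isSymmSndFDerivAt (by simp)
  let D := fderiv ℝ (fderiv ℝ θ) x
  have h1 (v w : E) : fderiv ℝ θ x (fderiv ℝ J x v w) =
      Complex.I • D v w - D v (J x w) := by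
    have h2 := hdθ.hasFDerivAt.clm_apply (hJ.hasFDerivAt.clm_apply (hasFDerivAt_const w x))
    have h3 := (hdθ.hasFDerivAt.clm_apply (hasFDerivAt_const w x)).const_smul Complex.I
    have h4 : (fun y => fderiv ℝ θ y (J y w)) =ᶠ[𝓝 x] fun y => Complex.I • fderiv ℝ θ y w :=
      hJθ.mono fun y hy => hy w
    have h5 := congrArg (fun L => L v) ((h2.congr_of_eventuallyEq h4.symm).unique h3)
    simp only [add_apply, smul_apply, ContinuousLinearMap.comp_apply,
      ContinuousLinearMap.flip_apply, zero_apply, map_zero, zero_add] at h5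
    exact eq_sub_of_add_eq h5
  apply hinj
  rw [map_zero]
  have h0 := hJθ.self_of_nhds
  have hs (v w : E) : D v w = D w v := hsymm v w
  simp only [nijenhuis, map_add, map_sub, h0, h1, smul_sub, smul_smul, Complex.I_mul_I]
  rw [hs b a, hs (J x b) (J x a), hs (J x b) a, hs (J x a) b]
  abel

end Nijenhuis

/-! ### Complexification of an integrable almost complex structure -/

section Integration

open Complexified
open Complex (I)

variable {E : Type u} [NormedAddCommGroup E] [NormedSpace ℝ E]

/-- The complexification of a real operator. -/
def Complexified.map (T : E →L[ℝ] E) : Complexified E →L[ℂ] Complexified E :=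
  extend (ofReal ∘L T)

lemma Complexified.map_apply (T : E →L[ℝ] E) (z : Complexified E) :
    Complexified.map T z = ofReal (T (re z)) + I • ofReal (T (im z)) := rfl

@[simp] lemma Complexified.map_ofReal (T : E →L[ℝ] E) (x : E) :
    Complexified.map T (ofReal x) = ofReal (T x) := extend_ofReal _ _

variable (E) in
/-- The complexification of real operators, as a real-linear operator. -/
def Complexified.mapL : (E →L[ℝ] E) →L[ℝ] (Complexified E →L[ℂ] Complexified E) :=
  extendL E (Complexified E) ∘L ContinuousLinearMap.compL ℝ E E (Complexified E) ofReal

variable [CompleteSpace E]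

/-- An analytic almost complex structure with vanishing Nijenhuis tensor extends holomorphically to
the complexification, and the extension has an involutive antiholomorphic distribution: the
identities `J ^ 2 = -1` and `nijenhuis J = 0` persist by the identity theorem, and the second one,
evaluated on vectors of `ker (K z + i)`, reads `2 i (K' b a - K' a b) = 0`. -/
lemma exists_complexified_structure {J : E → E →L[ℝ] E} {x₀ : E} (hJ : AnalyticAt ℝ J x₀)
    (hJJ : ∀ᶠ x in 𝓝 x₀, ∀ v, J x (J x v) = -v)
    (hN : ∀ᶠ x in 𝓝 x₀, ∀ a b, nijenhuis J x a b = 0) :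
    ∃ K : Complexified E → Complexified E →L[ℂ] Complexified E, AnalyticAt ℂ K (ofReal x₀) ∧
      (∀ᶠ x in 𝓝 x₀, K (ofReal x) = Complexified.map (J x)) ∧
      (∀ᶠ z in 𝓝 (ofReal x₀), ∀ v, K z (K z v) = -v) ∧
      ∀ᶠ z in 𝓝 (ofReal x₀), ∀ a b, K z a = -(I • a) → K z b = -(I • b) →
        fderiv ℂ K z b a = fderiv ℂ K z a b := by
  obtain ⟨K, hK, hKJ⟩ := exists_analyticAt_extension (((mapL E).analyticAt _).comp hJ)
  have hKJ' : ∀ᶠ x in 𝓝 x₀, K (ofReal x) = Complexified.map (J x) := hKJ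
  have hcont : Tendsto ofReal (𝓝 x₀) (𝓝 (ofReal x₀)) := ofReal.continuous.tendsto x₀
  have hdK : ∀ᶠ x in 𝓝 x₀, ∀ a b, fderiv ℂ K (ofReal x) (ofReal a) (ofReal b) =
      ofReal (fderiv ℝ J x a b) := by
    filter_upwards [hKJ.eventually_nhds, hcont.eventually hK.eventually_analyticAt,
      hJ.eventually_analyticAt] with x hx hKx hJx a b
    have h1 : HasFDerivAt (fun x => K (ofReal x))
        ((fderiv ℂ K (ofReal x)).restrictScalars ℝ ∘L ofReal) x :=
      (hKx.differentiableAt.hasFDerivAt.restrictScalars ℝ).comp x ofReal.hasFDerivAt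
    have h2 : HasFDerivAt (fun x => K (ofReal x)) (mapL E ∘L fderiv ℝ J x) x :=
      ((mapL E).hasFDerivAt.comp x hJx.differentiableAt.hasFDerivAt).congr_of_eventuallyEq hx
    have h3 := congrArg (fun L => L a (ofReal b)) (h1.unique h2)
    refine h3.trans ?_
    change Complexified.map (fderiv ℝ J x a) (ofReal b) = _
    rw [map_ofReal]
  have hKK : ∀ᶠ z in 𝓝 (ofReal x₀), ∀ v, K z (K z v) = -v := by
    have := eventually_forall_eq_zero_of_ofReal (x₀ := x₀) (ι := E)
      (g := fun v z => K z (K z (ofReal v)) + ofReal v) ?_ ?_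
    · filter_upwards [this] with z hz v
      have h1 (v : E) : K z (K z (ofReal v)) = -ofReal v := eq_neg_of_add_eq_zero_left (hz v)
      rw [eq_re_add_im v]
      simp only [map_add, map_smul, h1, neg_add, smul_neg]
    · filter_upwards [hK.eventually_analyticAt] with z hz v
      have := hz.differentiableAt
      fun_prop
    · filter_upwards [hJJ, hKJ'] with x hx hKx v
      rw [hKx, map_ofReal, map_ofReal, hx, map_neg, neg_add_cancel]
  refine ⟨K, hK, hKJ', hKK, ?_⟩
  have hNK : ∀ᶠ z in 𝓝 (ofReal x₀), ∀ a b, K z (fderiv ℂ K z b a) - K z (fderiv ℂ K z a b) -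
      fderiv ℂ K z (K z b) a + fderiv ℂ K z (K z a) b = 0 := by
    have := eventually_forall_eq_zero_of_ofReal (x₀ := x₀) (ι := E × E)
      (g := fun v z => K z (fderiv ℂ K z (ofReal v.2) (ofReal v.1)) -
        K z (fderiv ℂ K z (ofReal v.1) (ofReal v.2)) -
        fderiv ℂ K z (K z (ofReal v.2)) (ofReal v.1) +
        fderiv ℂ K z (K z (ofReal v.1)) (ofReal v.2)) ?_ ?_
    · filter_upwards [this] with z hz a b
      rw [eq_re_add_im a, eq_re_add_im b]
      have h1 := hz (re a, re b)
      have h2 := hz (re a, im b)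
      have h3 := hz (im a, re b)
      have h4 := hz (im a, im b)
      dsimp only at h1 h2 h3 h4
      simp only [map_add, map_smul, add_apply, smul_apply, smul_add]
      linear_combination (norm := module) h1 + I • h2 + I • h3 + (I * I) • h4
    · filter_upwards [hK.eventually_analyticAt] with z hz v
      have h1 := hz.differentiableAt
      have h2 := hz.fderiv.differentiableAt
      fun_prop
    · filter_upwards [hN, hdK, hKJ'] with x hx hdx hKx v
      rw [hKx]
      have h1 := congrArg ofReal (hx v.1 v.2)
      simpa only [nijenhuis, map_ofReal, hdx, map_sub, map_add, map_zero] using h1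
  filter_upwards [hNK, hKK.eventually_nhds, hK.eventually_analyticAt] with z hz hKz hKan a b ha hb
  have h1 (v w : Complexified E) : K z (fderiv ℂ K z v w) + fderiv ℂ K z v (K z w) = 0 := by
    have h2 := hKan.differentiableAt.hasFDerivAt.mul' hKan.differentiableAt.hasFDerivAt
    have h3 : (K * K) =ᶠ[𝓝 z] fun _ => -1 := by
      filter_upwards [hKz] with y hy
      exact ContinuousLinearMap.ext fun v => hy v
    have h4 := (h2.congr_of_eventuallyEq h3.symm).unique (hasFDerivAt_const _ z)
    exact congrArg (fun L => L v w) h4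
  have h5 := h1 b a
  have h6 := h1 a b
  rw [ha, map_neg, map_smul] at h5
  rw [hb, map_neg, map_smul] at h6
  have h7 := hz a b
  rw [ha, hb, eq_neg_of_add_eq_zero_left h5, eq_neg_of_add_eq_zero_left h6] at h7
  simp only [map_neg, map_smul, neg_apply, smul_apply, neg_neg] at h7
  have h8 : (2 * I) • (fderiv ℂ K z b a - fderiv ℂ K z a b) = 0 := by
    rw [← h7]; module
  exact sub_eq_zero.1 ((smul_eq_zero.1 h8).resolve_left (by simp))

end Integration

/-! ### Holomorphic charts on an open subset of a real Banach space -/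

section Integration

open Complexified
open Complex (I)

variable {E : Type u} [NormedAddCommGroup E] [NormedSpace ℝ E]

/-- The `i`-eigenspace of the complexification of a real operator, a complex Banach space. -/
abbrev Complexified.eigenspaceI (T : E →L[ℝ] E) : Submodule ℂ (Complexified E) :=
  LinearMap.ker (Complexified.map T - I • ContinuousLinearMap.id ℂ (Complexified E)).toLinearMap

lemma Complexified.mem_eigenspaceI {T : E →L[ℝ] E} {z : Complexified E} :
    z ∈ eigenspaceI T ↔ Complexified.map T z = I • z := by
  rw [LinearMap.mem_ker]; exact sub_eq_zero

instance [CompleteSpace E] (T : E →L[ℝ] E) : CompleteSpace (eigenspaceI T) :=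
  (ContinuousLinearMap.isClosed_ker _).completeSpace_coe

lemma Complexified.map_map_eq_neg {T : E →L[ℝ] E} (hT : ∀ v, T (T v) = -v) (z : Complexified E) :
    Complexified.map T (Complexified.map T z) = -z := by
  conv_rhs => rw [eq_re_add_im z]
  rw [map_apply T z, map_add, map_smul, map_ofReal, map_ofReal, hT, hT, map_neg, map_neg, smul_neg,
    neg_add]

/-- The projection `½ (1 - i T)` onto the `i`-eigenspace. -/
def Complexified.projI (T : E →L[ℝ] E) (hT : ∀ v, T (T v) = -v) :
    Complexified E →L[ℂ] eigenspaceI T :=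
  ((2⁻¹ : ℂ) • (ContinuousLinearMap.id ℂ (Complexified E) - I • Complexified.map T)).codRestrict
    (eigenspaceI T) fun z => by
      rw [mem_eigenspaceI]
      simp only [smul_apply, sub_apply, ContinuousLinearMap.id_apply, map_smul, map_sub,
        map_map_eq_neg hT]
      rw [smul_comm I (2⁻¹ : ℂ), smul_sub I, smul_smul I I, Complex.I_mul_I]
      module

lemma Complexified.coe_projI (T : E →L[ℝ] E) (hT : ∀ v, T (T v) = -v) (z : Complexified E) :
    (projI T hT z : Complexified E) = (2⁻¹ : ℂ) • (z - I • Complexified.map T z) := rfl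

lemma Complexified.projI_projI (T : E →L[ℝ] E) (hT : ∀ v, T (T v) = -v) (z : Complexified E) :
    projI T hT (projI T hT z) = projI T hT z := by
  apply Subtype.ext
  rw [coe_projI T hT (projI T hT z : Complexified E), mem_eigenspaceI.1 (projI T hT z).2,
    smul_smul, Complex.I_mul_I]
  module

/-- A real Banach space with a complex structure `T` is isomorphic to the `i`-eigenspace of `T` in
its complexification, by `v ↦ ½ (v - i T v)` with inverse `z ↦ 2 Re z`. -/
def Complexified.equivEigenspaceI (T : E →L[ℝ] E) (hT : ∀ v, T (T v) = -v) :
    E ≃L[ℝ] eigenspaceI T :=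
  ContinuousLinearEquiv.equivOfInverse
    ((projI T hT).restrictScalars ℝ ∘L ofReal)
    ((2 : ℝ) • (re ∘L ((eigenspaceI T).subtypeL.restrictScalars ℝ)))
    (fun v => by
      change (2 : ℝ) • re (projI T hT (ofReal v) : Complexified E) = v
      have h (z : Complexified E) : (2⁻¹ : ℂ) • z = (2⁻¹ : ℝ) • z := by
        rw [← Complex.coe_smul]; norm_num
      rw [coe_projI, h, map_smul, map_sub, re_I_smul, map_ofReal, re_ofReal, im_ofReal, neg_zero,
        sub_zero, smul_smul]
      norm_num)
    (fun z => by
      apply Subtype.ext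
      have hz := mem_eigenspaceI.1 z.2
      have hi : im (z : Complexified E) = - T (re (z : Complexified E)) := by
        have := congrArg re hz
        rw [map_apply, re_I_smul, map_add, re_ofReal, re_I_smul, im_ofReal, neg_zero,
          add_zero] at this
        rw [this, neg_neg]
      change (projI T hT (ofReal ((2 : ℝ) • re (z : Complexified E))) : Complexified E) = z
      have h (w : Complexified E) : (2 : ℝ) • w = (2 : ℂ) • w := by
        rw [← Complex.coe_smul]; norm_num
      rw [map_smul, coe_projI, h, map_smul, map_ofReal]
      conv_rhs => rw [eq_re_add_im (z : Complexified E), hi, map_neg]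
      module)

variable [CompleteSpace E]

/-- Around every point, an analytic almost complex structure with vanishing Nijenhuis tensor has a
chart into a complex Banach space that intertwines it with multiplication by `i`: restrict to the
real points the germ that `exists_intertwining` yields on the complexification. The chart is real
analytic in both directions on its whole domain. -/
lemma exists_holomorphic_chart {J : E → E →L[ℝ] E} {x₀ : E} {U : Set E} (hU : IsOpen U)
    (hx₀ : x₀ ∈ U) (hJ : AnalyticOnNhd ℝ J U) (hJJ : ∀ x ∈ U, ∀ v, J x (J x v) = -v)
    (hN : ∀ x ∈ U, ∀ a b, nijenhuis J x a b = 0) :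
    ∃ (F : Type u) (_ : NormedAddCommGroup F) (_ : NormedSpace ℂ F) (_ : CompleteSpace F)
      (ψ : OpenPartialHomeomorph E F), x₀ ∈ ψ.source ∧ ψ.source ⊆ U ∧
      AnalyticOnNhd ℝ ψ ψ.source ∧ AnalyticOnNhd ℝ ψ.symm ψ.target ∧
      ∀ x ∈ ψ.source, ∀ v, fderiv ℝ ψ x (J x v) = I • fderiv ℝ ψ x v := by
  have hUx : ∀ᶠ x in 𝓝 x₀, x ∈ U := hU.mem_nhds hx₀
  obtain ⟨K, hK, hKJ, hKK, hKint⟩ := exists_complexified_structure (hJ x₀ hx₀)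
    (hUx.mono hJJ) (hUx.mono hN)
  -- Move the base point to the origin.
  let z₀ := ofReal x₀
  have ht : Tendsto (fun z => z₀ + z) (𝓝 0) (𝓝 z₀) := by
    have : ContinuousAt (fun z => z₀ + z) 0 := by fun_prop
    simpa [ContinuousAt] using this
  have hd (z : Complexified E) : fderiv ℂ (fun z => K (z₀ + z)) z = fderiv ℂ K (z₀ + z) :=
    fderiv_comp_add_left z₀
  obtain ⟨φ, hφ, hdφ0, hdφ⟩ := exists_intertwining (J := fun z => K (z₀ + z))
    (AnalyticAt.comp (g := K) (f := fun z => z₀ + z) (by simpa using hK)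
      (analyticAt_const.add analyticAt_id))
    (ht.eventually hKK) (by
      filter_upwards [ht.eventually hKint] with z hz a b ha hb
      rw [hd]; exact hz a b ha hb)
  have hT := hJJ x₀ hx₀
  let T := J x₀
  have hKx₀ : K z₀ = Complexified.map T := hKJ.self_of_nhds
  let π : Complexified E →L[ℂ] eigenspaceI T := projI T hT
  let sh : E → Complexified E := fun x => ofReal x - z₀
  have hsh0 : sh x₀ = 0 := sub_self _
  have hsh (x : E) : AnalyticAt ℝ sh x := (ofReal.analyticAt x).sub analyticAt_const
  have hdsh (x : E) : HasFDerivAt sh ofReal x := ofReal.hasFDerivAt.sub_const _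
  have hsht : Tendsto sh (𝓝 x₀) (𝓝 0) := by
    have := (hsh x₀).continuousAt.tendsto
    rwa [hsh0] at this
  let f : E → eigenspaceI T := fun x => π (φ (sh x))
  have hf : AnalyticAt ℝ f x₀ := by
    have h1 : AnalyticAt ℂ (fun z => π (φ z)) (sh x₀) := by
      rw [hsh0]; exact (π.analyticAt _).comp hφ
    exact AnalyticAt.comp (g := fun z => π (φ z)) (h1.restrictScalars (𝕜 := ℝ)) (hsh x₀)
  have hdf : ∀ᶠ x in 𝓝 x₀, ∀ v, fderiv ℝ f x v = π (fderiv ℂ φ (sh x) (ofReal v)) := by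
    filter_upwards [hsht.eventually hφ.eventually_analyticAt] with x hx v
    have h1 : HasFDerivAt (fun z => π (φ z)) (π ∘L fderiv ℂ φ (sh x)) (sh x) :=
      π.hasFDerivAt.comp _ hx.differentiableAt.hasFDerivAt
    have h2 : HasFDerivAt f ((π ∘L fderiv ℂ φ (sh x)).restrictScalars ℝ ∘L ofReal) x :=
      HasFDerivAt.comp (g := fun z => π (φ z)) x (h1.restrictScalars ℝ) (hdsh x)
    rw [h2.fderiv]; rfl
  have hdf0 : fderiv ℝ f x₀ = (equivEigenspaceI T hT : E →L[ℝ] eigenspaceI T) := by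
    ext1 v
    rw [hdf.self_of_nhds v, hsh0, hdφ0]
    simp only [add_zero, hKx₀]
    exact projI_projI T hT (ofReal v)
  have hfJ : ∀ᶠ x in 𝓝 x₀, ∀ v, fderiv ℝ f x (J x v) = I • fderiv ℝ f x v := by
    filter_upwards [hdf, hsht.eventually hdφ, hKJ] with x hx hφx hKx v
    rw [hx, hx, ← map_smul, ← hφx]
    simp only [sh, add_sub_cancel, hKx, map_ofReal]
  have hfinv : ∀ᶠ x in 𝓝 x₀, ∃ i : E ≃L[ℝ] eigenspaceI T, fderiv ℝ f x = i := by
    have h1 : ContinuousAt (fderiv ℝ f) x₀ := hf.fderiv.continuousAt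
    have h2 := h1.eventually (by rw [hdf0]; exact (equivEigenspaceI T hT).nhds)
    filter_upwards [h2] with x ⟨i, hi⟩
    exact ⟨i, hi.symm⟩
  have cd : ContDiffAt ℝ ω f x₀ := hf.contDiffAt
  have hfd : HasFDerivAt f (equivEigenspaceI T hT : E →L[ℝ] eigenspaceI T) x₀ := by
    rw [← hdf0]; exact hf.differentiableAt.hasFDerivAt
  let e := cd.toOpenPartialHomeomorph f hfd (by simp)
  have he0 : x₀ ∈ e.source := cd.mem_toOpenPartialHomeomorph_source hfd (by simp)
  have hef : (e : E → eigenspaceI T) = f := cd.toOpenPartialHomeomorph_coe hfd (by simp)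
  obtain ⟨s, hs, hso, hx₀s⟩ := _root_.eventually_nhds_iff.1
    (hUx.and (hf.eventually_analyticAt.and (hfJ.and hfinv)))
  refine ⟨eigenspaceI T, inferInstance, inferInstance, inferInstance, e.restrOpen s hso,
    ⟨he0, hx₀s⟩, fun x hx => (hs x hx.2).1, fun x hx => ?_, fun y hy => ?_, fun x hx => ?_⟩
  · change AnalyticAt ℝ e x
    rw [hef]; exact (hs x hx.2).2.1
  · have hx := (e.restrOpen s hso).map_target hy
    obtain ⟨i, hi⟩ := (hs _ hx.2).2.2.2
    refine (e.restrOpen s hso).analyticAt_symm hy (i := i) ?_ ?_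
    · change AnalyticAt ℝ e _
      rw [hef]; exact (hs _ hx.2).2.1
    · change fderiv ℝ e _ = _
      rw [hef]; exact hi
  · change ∀ v, fderiv ℝ e x (J x v) = I • fderiv ℝ e x v
    rw [hef]; exact (hs x hx.2).2.2.1

end Integration

/-! ### Coordinate changes and brackets on a manifold -/

section ChartChange

variable {𝕜 : Type*} [NontriviallyNormedField 𝕜] {C : Type*} [TopologicalSpace C]
  {E : Type*} [NormedAddCommGroup E] [NormedSpace 𝕜 E]
  {F : Type*} [NormedAddCommGroup F] [NormedSpace 𝕜 F]
  {G : Type*} [NormedAddCommGroup G] [NormedSpace 𝕜 G]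

/-- The chain rule for coordinate changes. -/
lemma fderiv_chartChange_comp (c : OpenPartialHomeomorph C E) (d : OpenPartialHomeomorph C F)
    (e : OpenPartialHomeomorph C G) {y : C} (hc : y ∈ c.source) (hd : y ∈ d.source)
    (h₁ : DifferentiableAt 𝕜 (d ∘ c.symm) (c y)) (h₂ : DifferentiableAt 𝕜 (e ∘ d.symm) (d y)) :
    fderiv 𝕜 (e ∘ d.symm) (d y) ∘L fderiv 𝕜 (d ∘ c.symm) (c y) =
      fderiv 𝕜 (e ∘ c.symm) (c y) := by
  have hy : (d ∘ c.symm) (c y) = d y := by simp [c.left_inv hc]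
  rw [← hy] at h₂
  have h3 := (h₂.hasFDerivAt.comp (c y) h₁.hasFDerivAt)
  have h4 : (e ∘ c.symm) =ᶠ[𝓝 (c y)] (e ∘ d.symm) ∘ (d ∘ c.symm) := by
    have h5 : ∀ᶠ x in 𝓝 (c y), c.symm x ∈ d.source := by
      refine (c.continuousAt_symm (c.map_source hc)).eventually (d.open_source.mem_nhds ?_)
      rwa [c.left_inv hc]
    filter_upwards [h5] with x hx
    simp [d.left_inv hx]
  rw [(h3.congr_of_eventuallyEq h4).fderiv, hy]

lemma fderiv_chartChange_self (c : OpenPartialHomeomorph C E) {y : C} (hc : y ∈ c.source) :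
    fderiv 𝕜 (c ∘ c.symm) (c y) = ContinuousLinearMap.id 𝕜 E := by
  have h4 : (c ∘ c.symm) =ᶠ[𝓝 (c y)] id := by
    filter_upwards [c.open_target.mem_nhds (c.map_source hc)] with x hx
    exact c.right_inv hx
  rw [h4.fderiv_eq, fderiv_id]

lemma OpenPartialHomeomorph.fderiv_fderiv_symm (e : OpenPartialHomeomorph E F) {x : F}
    (hx : x ∈ e.target) (h₁ : DifferentiableAt 𝕜 e (e.symm x)) (h₂ : DifferentiableAt 𝕜 e.symm x)
    (w : F) : fderiv 𝕜 e (e.symm x) (fderiv 𝕜 e.symm x w) = w := by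
  have h3 : HasFDerivAt (e ∘ e.symm) (fderiv 𝕜 e (e.symm x) ∘L fderiv 𝕜 e.symm x) x :=
    h₁.hasFDerivAt.comp x h₂.hasFDerivAt
  have h4 : (e ∘ e.symm) =ᶠ[𝓝 x] id := e.eventually_right_inverse hx
  exact congrArg (fun L => L w) ((h3.congr_of_eventuallyEq h4.symm).unique (hasFDerivAt_id x))

end ChartChange

namespace AnalyticAtlas

section Coordinates

variable {𝕜 : Type*} [NontriviallyNormedField 𝕜] {C : Type v} [TopologicalSpace C]
  (A : AnalyticAtlas.{u, v} 𝕜 C)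

lemma analyticAt_chartChange {p q y : C} (hp : y ∈ (A.chart p).source)
    (hq : y ∈ (A.chart q).source) :
    AnalyticAt 𝕜 (A.chart q ∘ (A.chart p).symm) (A.chart p y) := by
  refine A.analytic_coordChange p q _ ⟨(A.chart p).map_source hp, ?_⟩
  change (A.chart p).symm (A.chart p y) ∈ (A.chart q).source
  rwa [(A.chart p).left_inv hp]

lemma toCoord_comp_ofCoord {p q y : C} (hp : y ∈ (A.chart p).source)
    (hq : y ∈ (A.chart q).source) :
    A.toCoord q y ∘L A.ofCoord p y = fderiv 𝕜 (A.chart q ∘ (A.chart p).symm) (A.chart p y) :=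
  fderiv_chartChange_comp _ _ _ hp (A.mem_chart_source y)
    (A.analyticAt_chartChange hp (A.mem_chart_source y)).differentiableAt
    (A.analyticAt_chartChange (A.mem_chart_source y) hq).differentiableAt

lemma toCoord_ofCoord {p y : C} (hp : y ∈ (A.chart p).source) (w : A.model p) :
    A.toCoord p y (A.ofCoord p y w) = w := by
  have := A.toCoord_comp_ofCoord hp hp
  rw [fderiv_chartChange_self _ hp] at this
  exact congrArg (fun L => L w) this

lemma ofCoord_toCoord {p y : C} (hp : y ∈ (A.chart p).source) (w : A.Tangent y) :
    A.ofCoord p y (A.toCoord p y w) = w := by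
  have := fderiv_chartChange_comp _ _ _ (A.mem_chart_source y) hp
    (A.analyticAt_chartChange (A.mem_chart_source y) hp).differentiableAt
    (A.analyticAt_chartChange hp (A.mem_chart_source y)).differentiableAt
  rw [fderiv_chartChange_self _ (A.mem_chart_source y)] at this
  exact congrArg (fun L => L w) this

lemma fderiv_chartChange_toCoord {p q y : C} (hp : y ∈ (A.chart p).source)
    (hq : y ∈ (A.chart q).source) (w : A.Tangent y) :
    fderiv 𝕜 (A.chart q ∘ (A.chart p).symm) (A.chart p y) (A.toCoord p y w) = A.toCoord q y w := by
  rw [← A.toCoord_comp_ofCoord hp hq, ContinuousLinearMap.comp_apply, A.ofCoord_toCoord hp]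

lemma toCoord_self (p : C) (w : A.Tangent p) : A.toCoord p p w = w :=
  congrArg (fun L => L w) (fderiv_chartChange_self (𝕜 := 𝕜) _ (A.mem_chart_source p))

lemma ofCoord_self (p : C) (w : A.Tangent p) : A.ofCoord p p w = w :=
  congrArg (fun L => L w) (fderiv_chartChange_self (𝕜 := 𝕜) _ (A.mem_chart_source p))

end Coordinates

section Fields

variable {C : Type v} [TopologicalSpace C] (A : AnalyticAtlas.{u, v} ℝ C)

lemma fieldCoord_chart {p y : C} (hp : y ∈ (A.chart p).source) (a : ∀ q, A.Tangent q) :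
    A.fieldCoord p a (A.chart p y) = A.toCoord p y (a y) := by
  rw [fieldCoord, (A.chart p).left_inv hp]

variable {A} in
lemma SmoothFieldOn.differentiableAt {a : ∀ q, A.Tangent q} {U : Set C}
    (ha : A.SmoothFieldOn a U) (hU : IsOpen U) {p y : C} (hp : y ∈ (A.chart p).source)
    (hy : y ∈ U) : DifferentiableAt ℝ (A.fieldCoord p a) (A.chart p y) := by
  refine ((ha p).contDiffAt ?_).differentiableAt (by simp)
  refine ((A.chart p).isOpen_inter_preimage_symm hU).mem_nhds ⟨(A.chart p).map_source hp, ?_⟩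
  rwa [mem_preimage, (A.chart p).left_inv hp]

/-- The bracket, defined with the chart chosen around each point, has the same expression in every
chart. -/
lemma toCoord_bracket {a b : ∀ q, A.Tangent q} {p y : C} (hp : y ∈ (A.chart p).source)
    (ha : DifferentiableAt ℝ (A.fieldCoord p a) (A.chart p y))
    (hb : DifferentiableAt ℝ (A.fieldCoord p b) (A.chart p y))
    (ha' : DifferentiableAt ℝ (A.fieldCoord y a) (A.chart y y))
    (hb' : DifferentiableAt ℝ (A.fieldCoord y b) (A.chart y y)) :
    A.toCoord p y (A.bracket a b y) =
      VectorField.lieBracket ℝ (A.fieldCoord p b) (A.fieldCoord p a) (A.chart p y) := by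
  have hy := A.mem_chart_source y
  let f := A.chart p ∘ (A.chart y).symm
  have hf : AnalyticAt ℝ f (A.chart y y) := A.analyticAt_chartChange hy hp
  have hfy : f (A.chart y y) = A.chart p y := by
    simp only [f, Function.comp_apply, (A.chart y).left_inv hy]
  have hrel (c : ∀ q, A.Tangent q) :
      (fun x => fderiv ℝ f x (A.fieldCoord y c x)) =ᶠ[𝓝 (A.chart y y)] A.fieldCoord p c ∘ f := by
    have h5 : ∀ᶠ x in 𝓝 (A.chart y y), (A.chart y).symm x ∈ (A.chart p).source := by
      refine ((A.chart y).continuousAt_symm ((A.chart y).map_source hy)).eventually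
        ((A.chart p).open_source.mem_nhds ?_)
      rwa [(A.chart y).left_inv hy]
    filter_upwards [h5, (A.chart y).open_target.mem_nhds ((A.chart y).map_source hy)] with x hx hxt
    have h6 := A.fderiv_chartChange_toCoord ((A.chart y).map_target hxt) hx
      (c ((A.chart y).symm x))
    rw [(A.chart y).right_inv hxt] at h6
    rw [Function.comp_apply, show f x = A.chart p ((A.chart y).symm x) from rfl,
      A.fieldCoord_chart hx]
    exact h6
  change fderiv ℝ f (A.chart y y) (VectorField.lieBracket ℝ (A.fieldCoord y b) (A.fieldCoord y a)
    (A.chart y y)) = _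
  have hcomp {c : ∀ q, A.Tangent q} (hc : DifferentiableAt ℝ (A.fieldCoord p c) (A.chart p y))
      (v : A.model y) : fderiv ℝ (fun x => fderiv ℝ f x (A.fieldCoord y c x)) (A.chart y y) v =
        fderiv ℝ (A.fieldCoord p c) (A.chart p y) (fderiv ℝ f (A.chart y y) v) := by
    rw [← hfy] at hc
    rw [(hrel c).fderiv_eq, fderiv_comp _ hc hf.differentiableAt, hfy]; rfl
  have hval (c : ∀ q, A.Tangent q) : fderiv ℝ f (A.chart y y) (A.fieldCoord y c (A.chart y y)) =
      A.fieldCoord p c (A.chart p y) := by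
    rw [← hfy]; exact (hrel c).self_of_nhds
  rw [VectorField.fderiv_apply_lieBracket (n := ω) hf.contDiffAt (by simp) ha' hb', hcomp ha,
    hcomp hb, hval, hval]
  rfl

lemma Equivalent.analyticAt {A B : AnalyticAtlas.{u, v} ℝ C} (h : A.Equivalent B) {p q y : C}
    (hp : y ∈ (A.chart p).source) (hq : y ∈ (B.chart q).source) :
    AnalyticAt ℝ (B.chart q ∘ (A.chart p).symm) (A.chart p y) ∧
      AnalyticAt ℝ (A.chart p ∘ (B.chart q).symm) (B.chart q y) := by
  refine ⟨(h p q).1 _ ⟨(A.chart p).map_source hp, ?_⟩, (h p q).2 _ ⟨(B.chart q).map_source hq, ?_⟩⟩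
  · change (A.chart p).symm (A.chart p y) ∈ (B.chart q).source
    rwa [(A.chart p).left_inv hp]
  · change (B.chart q).symm (B.chart q y) ∈ (A.chart p).source
    rwa [(B.chart q).left_inv hq]

end Fields

end AnalyticAtlas

namespace AnalyticAtlas

/-! ### The torsion of an almost complex structure -/

namespace AlmostComplex

variable {C : Type v} [TopologicalSpace C] {A : AnalyticAtlas.{u, v} ℝ C} (𝒥 : A.AlmostComplex)

/-- The coordinate expression of `J` in the chart around `p`, as a field of operators. -/
def coord (p : C) (x : A.model p) : A.model p →L[ℝ] A.model p :=
  A.toCoord p ((A.chart p).symm x) ∘L 𝒥.J ((A.chart p).symm x) ∘L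
    A.ofCoord p ((A.chart p).symm x)

lemma coord_toCoord {p y : C} (hp : y ∈ (A.chart p).source) (w : A.Tangent y) :
    𝒥.coord p (A.chart p y) (A.toCoord p y w) = A.toCoord p y (𝒥.J y w) := by
  simp only [coord, ContinuousLinearMap.comp_apply]
  rw [(A.chart p).left_inv hp, A.ofCoord_toCoord hp]

lemma coord_self (p : C) (w : A.Tangent p) : 𝒥.coord p (A.chart p p) w = 𝒥.J p w := by
  have := 𝒥.coord_toCoord (A.mem_chart_source p) w
  rwa [A.toCoord_self, A.toCoord_self] at this

lemma coord_coord {p : C} {x : A.model p} (hx : x ∈ (A.chart p).target) (v : A.model p) :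
    𝒥.coord p x (𝒥.coord p x v) = -v := by
  have h := (A.chart p).map_target hx
  simp only [coord, ContinuousLinearMap.comp_apply]
  rw [A.ofCoord_toCoord h, 𝒥.sq_eq_neg, map_neg, A.toCoord_ofCoord h]

variable {𝒥} in
/-- Joint analyticity of `(x, w) ↦ J_x w` gives analyticity of the operator-valued map `x ↦ J_x`,
which is the partial derivative of the former in `w`. -/
lemma IsAnalytic.analyticOnNhd_coord (h𝒥 : 𝒥.IsAnalytic) (p : C) :
    AnalyticOnNhd ℝ (𝒥.coord p) (A.chart p).target := by
  intro x hx
  let k : A.model p × A.model p → A.model p := fun z => 𝒥.coord p z.1 z.2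
  have hk : AnalyticOnNhd ℝ k ((A.chart p).target ×ˢ univ) := h𝒥 p
  have h1 : AnalyticAt ℝ (fun x : A.model p => fderiv ℝ k (x, 0)) x :=
    AnalyticAt.comp (g := fderiv ℝ k) (f := fun x : A.model p => (x, (0 : A.model p)))
      (hk (x, 0) ⟨hx, mem_univ _⟩).fderiv (analyticAt_id.prod analyticAt_const)
  have h2 : AnalyticAt ℝ (fun x : A.model p => fderiv ℝ k (x, 0) ∘L .inr ℝ (A.model p) (A.model p))
      x :=
    (((ContinuousLinearMap.compL ℝ (A.model p) (A.model p × A.model p) (A.model p)).flip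
      (.inr ℝ (A.model p) (A.model p))).analyticAt _).comp h1
  refine h2.congr ?_
  filter_upwards [(A.chart p).open_target.mem_nhds hx] with y hy
  have h3 : HasFDerivAt (fun w => k (y, w)) (fderiv ℝ k (y, 0) ∘L .inr ℝ (A.model p) (A.model p))
      0 :=
    (hk (y, 0) ⟨hy, mem_univ _⟩).differentiableAt.hasFDerivAt.comp 0
      (hasFDerivAt_prodMk_right y (0 : A.model p))
  exact h3.unique (𝒥.coord p y).hasFDerivAt

lemma fieldCoord_mapField_eventuallyEq (a : ∀ q, A.Tangent q) {p y : C}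
    (hp : y ∈ (A.chart p).source) : A.fieldCoord p (𝒥.mapField a) =ᶠ[𝓝 (A.chart p y)]
      fun x => 𝒥.coord p x (A.fieldCoord p a x) := by
  filter_upwards [(A.chart p).open_target.mem_nhds ((A.chart p).map_source hp)] with x hx
  have h := 𝒥.coord_toCoord ((A.chart p).map_target hx) (a ((A.chart p).symm x))
  rw [(A.chart p).right_inv hx] at h
  exact h.symm

/-- The vector field `J[Ja, b] + J[a, Jb] + [a, b] - [Ja, Jb]`. -/
def bracketTorsion (a b : ∀ q, A.Tangent q) (p : C) : A.Tangent p :=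
  𝒥.J p (A.bracket (𝒥.mapField a) b p) + 𝒥.J p (A.bracket a (𝒥.mapField b) p) +
    A.bracket a b p - A.bracket (𝒥.mapField a) (𝒥.mapField b) p

variable {𝒥}

lemma toCoord_bracketTorsion (h𝒥 : 𝒥.IsAnalytic) {a b : ∀ q, A.Tangent q} {U : Set C}
    (hU : IsOpen U) (ha : A.SmoothFieldOn a U) (hb : A.SmoothFieldOn b U) {p y : C}
    (hp : y ∈ (A.chart p).source) (hy : y ∈ U) :
    A.toCoord p y (𝒥.bracketTorsion a b y) =
      nijenhuis (𝒥.coord p) (A.chart p y) (A.toCoord p y (a y)) (A.toCoord p y (b y)) := by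
  have hJ {q : C} (hq : y ∈ (A.chart q).source) :
      DifferentiableAt ℝ (𝒥.coord q) (A.chart q y) :=
    (h𝒥.analyticOnNhd_coord q _ ((A.chart q).map_source hq)).differentiableAt
  have hd {c : ∀ q, A.Tangent q} (hc : A.SmoothFieldOn c U) {q : C}
      (hq : y ∈ (A.chart q).source) :
      DifferentiableAt ℝ (A.fieldCoord q c) (A.chart q y) := hc.differentiableAt hU hq hy
  have hm {c : ∀ q, A.Tangent q} (hc : A.SmoothFieldOn c U) {q : C}
      (hq : y ∈ (A.chart q).source) :
      DifferentiableAt ℝ (A.fieldCoord q (𝒥.mapField c)) (A.chart q y) :=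
    ((hJ hq).clm_apply (hd hc hq)).congr_of_eventuallyEq
      (𝒥.fieldCoord_mapField_eventuallyEq c hq)
  have hyy := A.mem_chart_source y
  have hea := 𝒥.fieldCoord_mapField_eventuallyEq a hp
  have heb := 𝒥.fieldCoord_mapField_eventuallyEq b hp
  rw [bracketTorsion, map_sub, map_add, map_add, ← 𝒥.coord_toCoord hp, ← 𝒥.coord_toCoord hp,
    A.toCoord_bracket hp (hm ha hp) (hd hb hp) (hm ha hyy) (hd hb hyy),
    A.toCoord_bracket hp (hd ha hp) (hm hb hp) (hd ha hyy) (hm hb hyy),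
    A.toCoord_bracket hp (hd ha hp) (hd hb hp) (hd ha hyy) (hd hb hyy),
    A.toCoord_bracket hp (hm ha hp) (hm hb hp) (hm ha hyy) (hm hb hyy),
    Filter.EventuallyEq.rfl.lieBracket_vectorField_eq hea,
    heb.lieBracket_vectorField_eq Filter.EventuallyEq.rfl,
    heb.lieBracket_vectorField_eq hea,
    lieBracket_mapField_eq_nijenhuis (hJ hp) (hd ha hp) (hd hb hp)
      (𝒥.coord_coord ((A.chart p).map_source hp)), A.fieldCoord_chart hp, A.fieldCoord_chart hp]

variable (A) in
/-- The vector field with constant coordinates `w` in the chart around `p`. -/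
def constField (p : C) (w : A.model p) : ∀ q, A.Tangent q := fun q => A.ofCoord p q w

variable (A) in
lemma smoothFieldOn_constField (p : C) (w : A.model p) :
    A.SmoothFieldOn (constField A p w) (A.chart p).source := by
  intro q x hx
  have hq := (A.chart q).map_target hx.1
  set y := (A.chart q).symm x with hy
  have hyx : A.chart q y = x := (A.chart q).right_inv hx.1
  have h1 : ContDiffAt ℝ ∞ (fun z => fderiv ℝ (A.chart q ∘ (A.chart p).symm)
      ((A.chart p ∘ (A.chart q).symm) z) w) x := by
    rw [← hyx]
    have h2 : AnalyticAt ℝ (fderiv ℝ (A.chart q ∘ (A.chart p).symm))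
        ((A.chart p ∘ (A.chart q).symm) (A.chart q y)) := by
      rw [Function.comp_apply, (A.chart q).left_inv hq]
      exact (A.analyticAt_chartChange hx.2 hq).fderiv
    have h3 := h2.comp (A.analyticAt_chartChange hq hx.2)
    exact h3.contDiffAt.clm_apply contDiffAt_const
  refine ContDiffAt.contDiffWithinAt (ContDiffAt.congr_of_eventuallyEq h1 ?_)
  filter_upwards [((A.chart q).isOpen_inter_preimage_symm (A.chart p).open_source).mem_nhds hx]
    with z hz
  have h3 := A.toCoord_comp_ofCoord hz.2 ((A.chart q).map_target hz.1)
  exact congrArg (fun L => L w) h3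

/-- A map `Ω` with the defining property of the torsion is given in every chart by the Nijenhuis
tensor: apply the property to fields with constant coordinates. -/
lemma toCoord_apply_ofCoord_eq_nijenhuis (h𝒥 : 𝒥.IsAnalytic)
    {Ω : ∀ p, A.Tangent p → A.Tangent p → A.Tangent p}
    (hΩ : ∀ (U : Set C), IsOpen U → ∀ a b : ∀ q, A.Tangent q,
      A.SmoothFieldOn a U → A.SmoothFieldOn b U → ∀ p ∈ U,
        Ω p (a p) (b p) = 𝒥.bracketTorsion a b p) {p y : C} (hp : y ∈ (A.chart p).source)
    (w₁ w₂ : A.model p) :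
    A.toCoord p y (Ω y (A.ofCoord p y w₁) (A.ofCoord p y w₂)) =
      nijenhuis (𝒥.coord p) (A.chart p y) w₁ w₂ := by
  have h1 := hΩ _ (A.chart p).open_source _ _ (smoothFieldOn_constField A p w₁)
    (smoothFieldOn_constField A p w₂) y hp
  have h2 := toCoord_bracketTorsion h𝒥 (A.chart p).open_source (smoothFieldOn_constField A p w₁)
    (smoothFieldOn_constField A p w₂) hp hp
  rw [← h1] at h2
  simpa only [constField, A.toCoord_ofCoord hp] using h2

lemma IsTorsion.eq_nijenhuis (h𝒥 : 𝒥.IsAnalytic)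
    {Ω : ∀ p, A.Tangent p → A.Tangent p → A.Tangent p} (hΩ : 𝒥.IsTorsion Ω) (p : C)
    (w₁ w₂ : A.Tangent p) : Ω p w₁ w₂ = nijenhuis (𝒥.coord p) (A.chart p p) w₁ w₂ := by
  have := toCoord_apply_ofCoord_eq_nijenhuis h𝒥 hΩ.apply_field (A.mem_chart_source p) w₁ w₂
  rwa [A.toCoord_self, A.ofCoord_self, A.ofCoord_self] at this

lemma isTorsion_nijenhuis (h𝒥 : 𝒥.IsAnalytic) :
    𝒥.IsTorsion fun p w₁ w₂ => nijenhuis (𝒥.coord p) (A.chart p p) w₁ w₂ := by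
  have happ : ∀ (U : Set C), IsOpen U → ∀ a b : ∀ q, A.Tangent q,
      A.SmoothFieldOn a U → A.SmoothFieldOn b U → ∀ p ∈ U,
      nijenhuis (𝒥.coord p) (A.chart p p) (a p) (b p) = 𝒥.bracketTorsion a b p := by
    intro U hU a b ha hb p hp
    have := toCoord_bracketTorsion h𝒥 hU ha hb (A.mem_chart_source p) hp
    rw [A.toCoord_self, A.toCoord_self, A.toCoord_self] at this
    exact this.symm
  refine ⟨fun p => ?_, happ⟩
  have h1 : ContDiffOn ℝ ∞ (fun z : A.model p × A.model p × A.model p =>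
      nijenhuis (𝒥.coord p) z.1 z.2.1 z.2.2) ((A.chart p).target ×ˢ univ) := by
    intro z hz
    have hJ : ContDiffAt ℝ ∞ (fun z : A.model p × A.model p × A.model p => 𝒥.coord p z.1) z :=
      ContDiffAt.comp (g := 𝒥.coord p) z (h𝒥.analyticOnNhd_coord p z.1 hz.1).contDiffAt
        contDiffAt_fst
    have hD : ContDiffAt ℝ ∞
        (fun z : A.model p × A.model p × A.model p => fderiv ℝ (𝒥.coord p) z.1) z :=
      ContDiffAt.comp (g := fderiv ℝ (𝒥.coord p)) z
        (h𝒥.analyticOnNhd_coord p z.1 hz.1).fderiv.contDiffAt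
        contDiffAt_fst
    have ha : ContDiffAt ℝ ∞ (fun z : A.model p × A.model p × A.model p => z.2.1) z := by fun_prop
    have hb : ContDiffAt ℝ ∞ (fun z : A.model p × A.model p × A.model p => z.2.2) z := by fun_prop
    exact (((hJ.clm_apply ((hD.clm_apply hb).clm_apply ha)).sub
      (hJ.clm_apply ((hD.clm_apply ha).clm_apply hb))).sub
      ((hD.clm_apply (hJ.clm_apply hb)).clm_apply ha)).add
      ((hD.clm_apply (hJ.clm_apply ha)).clm_apply hb) |>.contDiffWithinAt
  refine h1.congr fun z hz => ?_
  have h2 := toCoord_apply_ofCoord_eq_nijenhuis h𝒥 happ ((A.chart p).map_target hz.1) z.2.1 z.2.2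
  rwa [(A.chart p).right_inv hz.1] at h2

end AlmostComplex

end AnalyticAtlas

namespace AnalyticAtlas

/-! ### Torsion and complex atlases -/

namespace AlmostComplex

variable {C : Type v} [TopologicalSpace C] {A : AnalyticAtlas.{u, v} ℝ C} {𝒥 : A.AlmostComplex}

lemma fderiv_chartChange_coord {p q y : C} (hp : y ∈ (A.chart p).source)
    (hq : y ∈ (A.chart q).source) (v : A.model p) :
    fderiv ℝ (A.chart q ∘ (A.chart p).symm) (A.chart p y) (𝒥.coord p (A.chart p y) v) =
      𝒥.coord q (A.chart q y) (fderiv ℝ (A.chart q ∘ (A.chart p).symm) (A.chart p y) v) := by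
  rw [← A.toCoord_ofCoord hp v, 𝒥.coord_toCoord hp, A.fderiv_chartChange_toCoord hp hq,
    A.fderiv_chartChange_toCoord hp hq, 𝒥.coord_toCoord hq]

/-- If `J` is multiplication by `i` for the complex structure `B`, then the differential of every
coordinate change from a chart of `A` to a chart of `B` intertwines `J` with multiplication by `i`:
`IsMulI` says so for the chart of `B` chosen around the point, and coordinate changes of `B` have
complex-linear differentials. -/
lemma IsMulI.fderiv_coord {B : AnalyticAtlas.{u, v} ℂ C} (hAB : A.Equivalent B.underlyingReal)
    (hB : 𝒥.IsMulI B) {p y : C} (q : C) (hp : y ∈ (A.chart p).source)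
    (hq : y ∈ (B.chart q).source) (v : A.model p) :
    fderiv ℝ (B.chart q ∘ (A.chart p).symm) (A.chart p y) (𝒥.coord p (A.chart p y) v) =
      Complex.I • fderiv ℝ (B.chart q ∘ (A.chart p).symm) (A.chart p y) v := by
  have hyA := A.mem_chart_source y
  have hyB := B.mem_chart_source y
  have h1 := fderiv_chartChange_comp (𝕜 := ℝ) (A.chart y) (A.chart p) (B.chart q) hyA hp
    (A.analyticAt_chartChange hyA hp).differentiableAt
    (hAB.analyticAt hp hq).1.differentiableAt
  have h2 := fderiv_chartChange_comp (𝕜 := ℝ) (A.chart y) (B.chart y) (B.chart q) hyA hyB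
    (hAB.analyticAt hyA hyB).1.differentiableAt
    (B.underlyingReal.analyticAt_chartChange hyB hq).differentiableAt
  have h3 : fderiv ℝ (B.chart q ∘ (B.chart y).symm) (B.chart y y) =
      (fderiv ℂ (B.chart q ∘ (B.chart y).symm) (B.chart y y)).restrictScalars ℝ :=
    ((B.analyticAt_chartChange hyB hq).differentiableAt.hasFDerivAt.restrictScalars ℝ).fderiv
  have h4 (w : A.Tangent y) :
      fderiv ℝ (B.chart q ∘ (A.chart p).symm) (A.chart p y) (A.toCoord p y w) =
        fderiv ℂ (B.chart q ∘ (B.chart y).symm) (B.chart y y)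
          (A.tangentIdent B.underlyingReal y w) := by
    have h5 := congrArg (fun L => L w) (h1.trans h2.symm)
    refine h5.trans ?_
    rw [h3]; rfl
  rw [← A.toCoord_ofCoord hp v, 𝒥.coord_toCoord hp, h4, h4, hB, map_smul]

lemma nijenhuis_eq_zero_of_isMulI (h𝒥 : 𝒥.IsAnalytic) {B : AnalyticAtlas.{u, v} ℂ C}
    (hAB : A.Equivalent B.underlyingReal) (hB : 𝒥.IsMulI B) (p : C) (w₁ w₂ : A.model p) :
    nijenhuis (𝒥.coord p) (A.chart p p) w₁ w₂ = 0 := by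
  have hpA := A.mem_chart_source p
  have hpB := B.mem_chart_source p
  have han := hAB.analyticAt hpA hpB
  refine nijenhuis_eq_zero_of_fderiv_comp (θ := B.chart p ∘ (A.chart p).symm)
    (h𝒥.analyticOnNhd_coord p _ ((A.chart p).map_source hpA)).differentiableAt han.1.contDiffAt
    ?_ ?_ _ _
  · have h1 := fderiv_chartChange_comp (𝕜 := ℝ) (A.chart p) (B.chart p) (A.chart p) hpA hpB
      han.1.differentiableAt han.2.differentiableAt
    rw [fderiv_chartChange_self _ hpA] at h1
    exact Function.LeftInverse.injective fun v => congrArg (fun L => L v) h1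
  · have hmem : A.chart p p ∈ (A.chart p).target ∩ (A.chart p).symm ⁻¹' (B.chart p).source := by
      refine ⟨(A.chart p).map_source hpA, ?_⟩
      rwa [mem_preimage, (A.chart p).left_inv hpA]
    filter_upwards [((A.chart p).isOpen_inter_preimage_symm (B.chart p).open_source).mem_nhds hmem]
      with x hx v
    have := IsMulI.fderiv_coord hAB hB p ((A.chart p).map_target hx.1) hx.2 v
    rwa [(A.chart p).right_inv hx.1] at this

/-- The charts of `A`, composed with the charts that `exists_holomorphic_chart` yields, form a
complex atlas: its coordinate changes are real analytic, and their differentials commute with `i` because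
both charts intertwine it with `J`. -/
lemma exists_complex_atlas (h𝒥 : 𝒥.IsAnalytic)
    (hN : ∀ p, ∀ x ∈ (A.chart p).target, ∀ a b, nijenhuis (𝒥.coord p) x a b = 0) :
    ∃ B : AnalyticAtlas.{u, v} ℂ C, A.Equivalent B.underlyingReal ∧ 𝒥.IsMulI B := by
  choose F hF₁ hF₂ hF₃ ψ hψp hψs hψ hψsymm hψJ using fun p =>
    exists_holomorphic_chart (A.chart p).open_target
    ((A.chart p).map_source (A.mem_chart_source p)) (h𝒥.analyticOnNhd_coord p)
    (fun x hx => 𝒥.coord_coord hx) (hN p)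
  have hψsI (p : C) (x : F p) (hx : x ∈ (ψ p).target) (w : F p) :
      fderiv ℝ (ψ p).symm x (Complex.I • w) =
        𝒥.coord p ((ψ p).symm x) (fderiv ℝ (ψ p).symm x w) := by
    have h1 := hψJ p _ ((ψ p).map_target hx) (fderiv ℝ (ψ p).symm x w)
    have hd₁ := (hψ p _ ((ψ p).map_target hx)).differentiableAt
    have hd₂ := (hψsymm p x hx).differentiableAt
    rw [(ψ p).fderiv_fderiv_symm hx hd₁ hd₂] at h1
    rw [← h1]
    have hx' := (ψ p).map_target hx
    have h2 := (ψ p).symm.fderiv_fderiv_symm (x := (ψ p).symm x) hx'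
      (by rw [(ψ p).symm_symm, (ψ p).right_inv hx]; exact hd₂) hd₁
    rw [(ψ p).symm_symm, (ψ p).right_inv hx] at h2
    exact h2 _
  let chart (p : C) : OpenPartialHomeomorph C (F p) := (A.chart p).trans (ψ p)
  have hBA (p q : C) (x : F p) (hx : x ∈ (chart p).target)
      (hq : (chart p).symm x ∈ (A.chart q).source) :
      AnalyticAt ℝ (A.chart q ∘ (chart p).symm) x :=
    AnalyticAt.comp (g := A.chart q ∘ (A.chart p).symm) (f := (ψ p).symm)
      (A.analytic_coordChange p q _ ⟨hx.2, hq⟩) (hψsymm p _ hx.1)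
  have hBBan (p q : C) (x : F p) (hx : x ∈ ((chart p).symm.trans (chart q)).source) :
      AnalyticAt ℝ (chart q ∘ (chart p).symm) x :=
    AnalyticAt.comp (g := ψ q) (f := A.chart q ∘ (chart p).symm) (hψ q _ hx.2.2)
      (hBA p q x hx.1 hx.2.1)
  have hBBI (p q : C) (x : F p) (hx : x ∈ ((chart p).symm.trans (chart q)).source) (w : F p) :
      fderiv ℝ (chart q ∘ (chart p).symm) x (Complex.I • w) =
        Complex.I • fderiv ℝ (chart q ∘ (chart p).symm) x w := by
    have h1 := (hψsymm p x hx.1.1).differentiableAt.hasFDerivAt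
    have h2 : HasFDerivAt (A.chart q ∘ (A.chart p).symm) _ ((ψ p).symm x) :=
      (A.analytic_coordChange p q ((ψ p).symm x)
        ⟨hx.1.2, hx.2.1⟩).differentiableAt.hasFDerivAt
    have h3 : HasFDerivAt (ψ q) _ (A.chart q ((A.chart p).symm ((ψ p).symm x))) :=
      (hψ q _ hx.2.2).differentiableAt.hasFDerivAt
    have h4 : HasFDerivAt (chart q ∘ (chart p).symm) _ x :=
      HasFDerivAt.comp (g := ψ q) (f := (A.chart q ∘ (A.chart p).symm) ∘ (ψ p).symm) x h3
        (h2.comp x h1)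
    have h5 := A.chart p |>.map_target hx.1.2
    have h6 := fderiv_chartChange_coord (𝒥 := 𝒥) h5 hx.2.1 (fderiv ℝ (ψ p).symm x w)
    rw [(A.chart p).right_inv hx.1.2] at h6
    rw [h4.fderiv]
    simp only [ContinuousLinearMap.comp_apply]
    rw [hψsI p x hx.1.1, h6]
    exact hψJ q _ hx.2.2 _
  let B : AnalyticAtlas.{u, v} ℂ C :=
    { model := F
      normedAddCommGroup := hF₁
      normedSpace := hF₂
      completeSpace := hF₃
      chart := chart
      mem_chart_source := fun p => ⟨A.mem_chart_source p, hψp p⟩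
      analytic_coordChange := fun p q x hx => by
        refine (hBBan p q x hx).complex_of_real ?_
        filter_upwards [((chart p).symm.trans (chart q)).open_source.mem_nhds hx] with z hz
        exact hBBI p q z hz }
  refine ⟨B, fun p q => ⟨fun x hx => ?_, fun x hx => ?_⟩, fun p w => ?_⟩
  · exact AnalyticAt.comp (g := ψ q) (f := A.chart q ∘ (A.chart p).symm) (hψ q _ hx.2.2)
      (A.analytic_coordChange p q x ⟨hx.1, hx.2.1⟩)
  · exact hBA q p x hx.1 hx.2
  · have h1 : A.tangentIdent B.underlyingReal p = fderiv ℝ (ψ p) (A.chart p p) := by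
      refine Filter.EventuallyEq.fderiv_eq ?_
      filter_upwards [(A.chart p).open_target.mem_nhds
        ((A.chart p).map_source (A.mem_chart_source p))] with z hz
      change ψ p (A.chart p ((A.chart p).symm z)) = _
      rw [(A.chart p).right_inv hz]
    rw [h1, ← 𝒥.coord_self p w]
    exact hψJ p _ (hψp p) w

end AlmostComplex

end AnalyticAtlas

end

theorem theorem7 {C : Type v} [TopologicalSpace C] (A : AnalyticAtlas.{u, v} ℝ C)
    (𝒥 : A.AlmostComplex) (h𝒥 : 𝒥.IsAnalytic) :
    (∃! Ω : ∀ p, A.Tangent p → A.Tangent p → A.Tangent p, 𝒥.IsTorsion Ω) ∧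
    ∀ Ω : ∀ p, A.Tangent p → A.Tangent p → A.Tangent p, 𝒥.IsTorsion Ω →
      ((∀ p w₁ w₂, Ω p w₁ w₂ = 0) ↔
        ∃ B : AnalyticAtlas.{u, v} ℂ C, A.Equivalent B.underlyingReal ∧ 𝒥.IsMulI B) := by
  refine ⟨⟨_, AnalyticAtlas.AlmostComplex.isTorsion_nijenhuis h𝒥, fun Ω hΩ => ?_⟩,
    fun Ω hΩ => ⟨fun h0 => ?_, ?_⟩⟩
  · funext p w₁ w₂
    exact hΩ.eq_nijenhuis h𝒥 p w₁ w₂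
  · refine AnalyticAtlas.AlmostComplex.exists_complex_atlas h𝒥 fun p x hx a b => ?_
    have h1 := AnalyticAtlas.AlmostComplex.toCoord_apply_ofCoord_eq_nijenhuis h𝒥 hΩ.apply_field
      ((A.chart p).map_target hx) a b
    rw [h0, map_zero, (A.chart p).right_inv hx] at h1
    exact h1.symm
  · rintro ⟨B, hAB, hB⟩ p w₁ w₂
    rw [hΩ.eq_nijenhuis h𝒥]
    exact AnalyticAtlas.AlmostComplex.nijenhuis_eq_zero_of_isMulI h𝒥 hAB hB p w₁ w₂
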